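/- Notation. A domain is a nonempty connected open set. For $U\subset\mathbb R^3$ and $r>0$, let $U^{r}=\{x:\operatorname{dist}(x,U)<r\}$. A domain $E\subset\mathbb R^3$ is of class $C^{1,\alpha}$ with constants $\rho_0,M_0$ if for every $P\in\partial E$ there are rigid coordinates in which $P=0$ and $E\cap B_{\rho_0}(0)=\{x\in B_{\rho_0}(0): x_3>\varphi(x')\}$, where $\varphi$ is $C^1$ on the disc $B'_{\rho_0}$, $\varphi(0)=0$, $\nabla\varphi(0)=0$ and $\|\varphi\|_{\infty}+\rho_0\|\nabla\varphi\|_\infty+\rho_0^{1+\alpha}|\nabla\varphi|_{\alpha}\le M_0\rho_0$ on $B'_{\rho_0}$ ($|\cdot|_\alpha$ is the Hölder seminorm). Setting. Let $M_0,M_1,\rho_0>0$ and $0<\alpha<1$. Let $\Omega\subset\mathbb R^3$ be a bounded domain of class $C^{1,\alpha}$ with constants $\rho_0,M_0$, with $|\Omega|\le M_1\rho_0^3$ and $\mathbb R^3\setminus\overline\Omega$ connected. Let $D_1,D_2\subset\Omega$ be domains of class $C^{1,\alpha}$ with constants $\rho_0,M_0$ such that $\mathbb R^3\setminus\overline{D_i}$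 is connected, $i=1,2$. Let $\mathcal G$ be the connected component of $\mathbb R^3\setminus\overline{D_1\cup D_2}$ containing $\mathbb R^3\setminus\overline\Omega$, and let $\Omega_D=\mathbb R^3\setminus\overline{\mathcal G}$. Let $$d_\mu=\max\Big\{\max_{x\in\partial D_1\cap\partial\Omega_D}\operatorname{dist}(x,D_2),\ \max_{x\in\partial D_2\cap\partial\Omega_D}\operatorname{dist}(x,D_1)\Big\}$$ (a maximum over the empty set being $0$), and assume that $d_\mu=\max_{x\in\partial D_1\cap\partial\Omega_D}\operatorname{dist}(x,\partial D_2)$. Let $S_{2\rho_0}=\{x:\rho_0<\operatorname{dist}(x,\overline\Omega)<2\rho_0\}$. For a point $P$, a unit vector $\nu$, numbers $0<R<d$ and a path $\gamma$, let $$V(\gamma)=\bigcup_{S\in\gamma}B_R(S)\ \cup\ C\Big(P,\nu,\tfrac{d^2-R^2}{d},\arcsin\tfrac Rd\Big),$$ where $$C(P,\nu,h,\vartheta)=\{x: |(x-P)-((x-P)\cdot\nu)\nu|\le\sin\vartheta\,|x-P|,\ 0\le (x-P)\cdot\nu\le h\}.$$ Lemma. There are positive constants $\bar d$, $L_0$,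 $c_1$ with $L_0\le M_0$, where $\bar d/\rho_0$ and $L_0$ depend only on $M_0,\alpha$, and $c_1$ depends only on $M_0,\alpha,M_1$, such that in the above setting there is a point $P\in\partial D_1\cap\partial\Omega_D$ with $$c_1 d_\mu\le\operatorname{dist}(P,D_2)$$ and with the following property, where $\nu$ is the outer unit normal to $D_1$ at $P$. For every $P_0\in S_{2\rho_0}$ there is a path $\gamma\subset(\overline{\Omega^{\rho_0}}\cup S_{2\rho_0})\setminus\overline{\Omega_D}$ joining $P_0$ to $P+\bar d\nu$ such that, with $d=\bar d$ and $R=\bar d/\sqrt{1+L_0^2}$, $$V(\gamma)\subset\mathbb R^3\setminus\Omega_D .$$ -/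

import Mathlib

open Set Metric MeasureTheory Filter Topology
open scoped ENNReal

noncomputable section

/-- The Euclidean plane. -/
abbrev Euc2 := EuclideanSpace ℝ (Fin 2)

/-- Euclidean three-space. -/
abbrev Euc3 := EuclideanSpace ℝ (Fin 3)

/-- A domain of `ℝ³`: a nonempty connected open set. -/
def IsDomain3 (E : Set Euc3) : Prop := IsOpen E ∧ IsConnected E

/-- The dimensionally normalized `C^{1,α}` norm on the disc `B'_r`,
`‖φ‖_∞ + r ‖∇φ‖_∞ + r^{1+α} |∇φ|_α`, with values in `[0,∞]`. -/
def normC1Holder (r α : ℝ) (φ : Euc2 → ℝ) : ℝ≥0∞ :=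
  (⨆ x ∈ ball (0 : Euc2) r, ENNReal.ofReal |φ x|)
  + ENNReal.ofReal r * (⨆ x ∈ ball (0 : Euc2) r, ENNReal.ofReal ‖fderiv ℝ φ x‖)
  + ENNReal.ofReal (r ^ (1 + α)) *
      (⨆ x ∈ ball (0 : Euc2) r, ⨆ y ∈ ball (0 : Euc2) r, ⨆ _ : x ≠ y,
        ENNReal.ofReal (‖fderiv ℝ φ x - fderiv ℝ φ y‖ / ‖x - y‖ ^ α))

/-- `E` is of class `C^{1,α}` with constants `ρ₀`, `M₀`: near each boundary point `P`, in suitable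
rigid coordinates `T` with `T P = 0`, the set `E ∩ B_{ρ₀}` is `{x ∈ B_{ρ₀} | x₃ > φ(x')}`. -/
def IsOfClassC1Holder (α ρ₀ M₀ : ℝ) (E : Set Euc3) : Prop :=
  ∀ P ∈ frontier E, ∃ (T : Euc3 ≃ᵃⁱ[ℝ] Euc3) (φ : Euc2 → ℝ),
    T P = 0 ∧
    (T '' E) ∩ ball 0 ρ₀ = {x : Euc3 | x ∈ ball 0 ρ₀ ∧ φ !₂[x 0, x 1] < x 2} ∧
    ContDiffOn ℝ 1 φ (ball 0 ρ₀) ∧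
    φ 0 = 0 ∧
    fderiv ℝ φ 0 = 0 ∧
    normC1Holder ρ₀ α φ ≤ ENNReal.ofReal (M₀ * ρ₀)

/-- `ν` is the outer unit normal to `E` at the boundary point `P`: a unit vector such that, for
every `ε > 0`, near `P` the cone `⟨x - P, ν⟩ < -ε |x - P|` lies in `E` and the cone
`⟨x - P, ν⟩ > ε |x - P|` lies outside `E`. -/
def IsOuterUnitNormal (E : Set Euc3) (P ν : Euc3) : Prop :=
  P ∈ frontier E ∧ ‖ν‖ = 1 ∧
  ∀ ε > (0 : ℝ), ∀ᶠ x in 𝓝 P,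
    (inner ℝ (x - P) ν < -(ε * ‖x - P‖) → x ∈ E) ∧
    (ε * ‖x - P‖ < inner ℝ (x - P) ν → x ∉ E)

/-- `𝒢`: the union of the connected components of `ℝ³ \ closure (D₁ ∪ D₂)` that meet
`ℝ³ \ closure Ω`. When `D₁, D₂ ⊆ Ω` and `ℝ³ \ closure Ω` is connected and nonempty, this is the
connected component containing `ℝ³ \ closure Ω`. -/
def exteriorComponent (Ω D₁ D₂ : Set Euc3) : Set Euc3 :=
  ⋃ x ∈ (closure Ω)ᶜ, connectedComponentIn (closure (D₁ ∪ D₂))ᶜ x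

/-- `Ω_D = ℝ³ \ closure 𝒢`. -/
def filledUnion (Ω D₁ D₂ : Set Euc3) : Set Euc3 :=
  (closure (exteriorComponent Ω D₁ D₂))ᶜ

/-- The modified distance `d_μ(D₁, D₂)` (a maximum over an empty set counts as `0`). -/
def modifiedDist (Ω D₁ D₂ : Set Euc3) : ℝ :=
  max (sSup ((fun x => infDist x D₂) '' (frontier D₁ ∩ frontier (filledUnion Ω D₁ D₂))))
      (sSup ((fun x => infDist x D₁) '' (frontier D₂ ∩ frontier (filledUnion Ω D₁ D₂))))

/-- The shell `S_{2ρ₀} = {x | ρ₀ < dist(x, closure Ω) < 2ρ₀}`. -/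
def outerShell (Ω : Set Euc3) (ρ₀ : ℝ) : Set Euc3 :=
  {x | ρ₀ < infDist x (closure Ω) ∧ infDist x (closure Ω) < 2 * ρ₀}

/-- The closed truncated cone `C(P, v, h, ϑ)` with vertex `P`, axis direction `v`, height `h` and
aperture `2ϑ`. -/
def truncatedCone (P v : Euc3) (h ϑ : ℝ) : Set Euc3 :=
  {x | ‖(x - P) - (inner ℝ (x - P) v : ℝ) • v‖ ≤ Real.sin ϑ * ‖x - P‖ ∧
       0 ≤ (inner ℝ (x - P) v : ℝ) ∧ (inner ℝ (x - P) v : ℝ) ≤ h}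

/-- `V(γ)`: the tube of radius `R` around the curve `γ` together with the cone
`C(P, ν, (d² - R²)/d, arcsin (R/d))`. -/
def tubeWithCone (P ν : Euc3) (d R : ℝ) (γ : Set Euc3) : Set Euc3 :=
  (⋃ S ∈ γ, ball S R) ∪ truncatedCone P ν ((d ^ 2 - R ^ 2) / d) (Real.arcsin (R / d))

end

/-! The regularity hypothesis enters as a cone condition, `DownwardIn`. Near a boundary point the
gradient of the graph is small, so at a uniform scale `s`, comparable to `ρ₀`, each of `Ω`, `D₁`,
`D₂` is closed under moving down a wide cone about its outer normal. All motions use balls of one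
radius `d`, much smaller than `s`, that avoid `D₁ ∪ D₂`. The difficulty is that the exterior of the
union may have thin wedges where the two surfaces meet, through which such a ball cannot pass.

The proof rests on a dichotomy. In the first case some ball that comes from the shell can be brought
to touch `D₁` at a point `P` whose distance from `D₂` is at least a fixed multiple of `d`. This `P`
is accessible, and since `d_μ` is at most the diameter of `Ω`, which the volume controls, a small
`c₁` gives the distance bound.

In the second case the normals of `D₁` and `D₂` are nearly parallel wherever both surfaces come near
a reached ball. Otherwise the ball could be pushed along the difference of the normals, away from
`D₂` and into `D₁`, and it would touch `D₁` far from `D₂` (`exists_touching_ball`,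
`le_dist_of_disjoint_ball`). So near reached balls the union itself satisfies a cone condition, and
reachability continues along any connected set in the exterior
(`IsPreconnected.exists_joinedIn_clearCenters`). The part of `𝒢` within `ρ₀` of `Ω` is connected,
because Euclidean space is simply connected (`IsPreconnected.inter_of_union_eq_univ`). Hence the
point realizing the maximum in `d_μ` is itself accessible. -/

/-! ### Connectedness of intersections in a simply connected space. -/

/-- Two preconnected open sets that cover a simply connected space have a preconnected
intersection. -/
theorem IsPreconnected.inter_of_union_eq_univ {X : Type*} [TopologicalSpace X]
    [SimplyConnectedSpace X] [LocallyPathConnectedSpace X] [NormalSpace X] {U V : Set X}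
    (hU : IsOpen U) (hV : IsOpen V) (cU : IsPreconnected U) (cV : IsPreconnected V)
    (hUV : U ∪ V = univ) : IsPreconnected (U ∩ V) := by
  intro A₀ B₀ hA₀ hB₀ hcov hA hB
  by_contra hne
  have hdisj : ∀ x ∈ U ∩ V, x ∈ A₀ → x ∉ B₀ := fun x hx ha hb => hne ⟨x, hx, ha, hb⟩
  set A := (U ∩ V) ∩ A₀ with hAdef
  have hAo : IsOpen A := (hU.inter hV).inter hA₀
  have hfr : ∀ x ∈ frontier A, x ∉ U ∩ V := by
    intro x hx hxUV
    rw [hAo.frontier_eq] at hx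
    have hxB : x ∈ B₀ := (hcov hxUV).resolve_left fun h => hx.2 ⟨hxUV, h⟩
    obtain ⟨y, hyB, hyA⟩ := mem_closure_iff.1 hx.1 _ hB₀ hxB
    exact hdisj y hyA.1 hyA.2 hyB
  obtain ⟨l, hl0, hl1, -⟩ := exists_continuous_zero_one_of_isClosed hU.isClosed_compl
    hV.isClosed_compl (by
      rw [disjoint_compl_left_iff_subset]
      intro x hx
      exact (hUV.symm ▸ mem_univ x : x ∈ U ∪ V).resolve_right hx)
  classical
  -- If `U ∩ V` splits into `A` and the rest, the circle-valued map equal to `l` mod 1 on `A` and 0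
  -- elsewhere has the real lifts `gU` over `U` and `gV` over `V`. They are continuous because a
  -- frontier point of `A` leaves `U ∩ V`, where `l` is 1 (outside `V`) or 0 (outside `U`).
  set gU : X → ℝ := A.piecewise (fun x => l x - 1) 0
  set gV : X → ℝ := A.piecewise l 0
  have cgU : ContinuousOn gU U := by
    apply ContinuousOn.piecewise
    · intro x hx
      have : x ∈ Vᶜ := fun h => hfr x hx.2 ⟨hx.1, h⟩
      simp [hl1 this]
    · exact (l.continuous.sub continuous_const).continuousOn
    · exact continuousOn_const
  have cgV : ContinuousOn gV V := by
    apply ContinuousOn.piecewise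
    · intro x hx
      have : x ∈ Uᶜ := fun h => hfr x hx.2 ⟨h, hx.1⟩
      simp [hl0 this]
    · exact l.continuous.continuousOn
    · exact continuousOn_const
  set f : X → AddCircle (1 : ℝ) := fun x => (gV x : AddCircle (1 : ℝ))
  have hfU : ∀ x, f x = (gU x : AddCircle (1 : ℝ)) := by
    intro x
    by_cases hx : x ∈ A
    · simp only [f, gU, gV, piecewise_eq_of_mem _ _ _ hx]
      rw [AddCircle.coe_sub, AddCircle.coe_period, sub_zero]
    · simp [f, gU, gV, hx]
  have cmk : Continuous ((↑) : ℝ → AddCircle (1 : ℝ)) := AddCircle.continuous_mk' 1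
  have cf : Continuous f := by
    rw [← continuousOn_univ, ← hUV]
    refine ContinuousOn.union_of_isOpen ?_ (cmk.comp_continuousOn cgV) hU hV
    exact (cmk.comp_continuousOn cgU).congr fun x _ => hfU x
  obtain ⟨b, hb⟩ := hB
  obtain ⟨a, ha⟩ := hA
  obtain ⟨h, ⟨-, hh⟩, -⟩ := (AddCircle.isCoveringMap_coe (1 : ℝ)).existsUnique_continuousMap_lifts
    ⟨f, cf⟩ a (gV a) rfl
  have hh' : ∀ x, (h x : AddCircle (1 : ℝ)) = f x := fun x => congrFun hh x
  have key : ∀ (W : Set X) (g : X → ℝ), IsPreconnected W → ContinuousOn g W →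
      (∀ x, f x = (g x : AddCircle (1 : ℝ))) → ∀ x ∈ W, ∀ y ∈ W, h x - g x = h y - g y := by
    intro W g cW cg hg x hx y hy
    refine cW.constant_of_mapsTo (T := (AddSubgroup.zmultiples (1 : ℝ) : Set ℝ))
      (isDiscrete_iff_discreteTopology.2
        (inferInstanceAs (DiscreteTopology (AddSubgroup.zmultiples (1 : ℝ)))))
      (f := fun x => h x - g x) (h.continuous.continuousOn.sub cg) ?_ hx hy
    intro z _
    have : ((h z - g z : ℝ) : AddCircle (1 : ℝ)) = 0 := by
      rw [AddCircle.coe_sub, hh', hg, sub_self]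
    exact (QuotientAddGroup.eq_zero_iff _).1 this
  have hbA : b ∉ A := fun hbA => hdisj b hb.1 hbA.2 hb.2
  have haA : a ∈ A := ha
  -- A global lift `h` differs from each local lift by a constant. From `a` to `b` the two local
  -- lifts change by amounts differing by exactly 1, which is the contradiction.
  have e1 := key U gU cU cgU hfU a ha.1.1 b hb.1.1
  have e2 := key V gV cV cgV (fun _ => rfl) a ha.1.2 b hb.1.2
  simp only [gU, gV, piecewise_eq_of_mem _ _ _ haA, piecewise_eq_of_notMem _ _ _ hbA,
    Pi.zero_apply] at e1 e2
  linarith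

theorem isPreconnected_inter_of_union_eq_univ_of_normedSpace {V : Type*} [NormedAddCommGroup V]
    [NormedSpace ℝ V] {A B : Set V} (hA : IsOpen A) (hB : IsOpen B) (cA : IsPreconnected A)
    (cB : IsPreconnected B) (h : A ∪ B = univ) : IsPreconnected (A ∩ B) :=
  IsPreconnected.inter_of_union_eq_univ hA hB cA cB h

/-! ### Geometry of the cone condition. -/

theorem inner_sub_unit_right {V : Type*} [NormedAddCommGroup V] [InnerProductSpace ℝ V]
    {m n : V} (hm : ‖m‖ = 1) (hn : ‖n‖ = 1) : inner ℝ (m - n) n = -(‖m - n‖ ^ 2 / 2) := by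
  rw [norm_sub_sq_real, inner_sub_left, real_inner_self_eq_norm_sq, hm, hn]; ring

theorem inner_sub_unit_left {V : Type*} [NormedAddCommGroup V] [InnerProductSpace ℝ V]
    {m n : V} (hm : ‖m‖ = 1) (hn : ‖n‖ = 1) : inner ℝ (m - n) m = ‖m - n‖ ^ 2 / 2 := by
  rw [norm_sub_sq_real, inner_sub_left, real_inner_self_eq_norm_sq, hm, hn, real_inner_comm]; ring

/-- Within the ball `ball c s`, the set `E` is closed under moving down along the cone of
directions `w` with `a ‖w‖ ≤ -⟪w, n⟫`. -/
def DownwardIn {V : Type*} [NormedAddCommGroup V] [InnerProductSpace ℝ V]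
    (E : Set V) (c : V) (s a : ℝ) (n : V) : Prop :=
  ∀ q ∈ E, q ∈ ball c s → ∀ y ∈ ball c s, a * ‖q - y‖ ≤ inner ℝ (q - y) n → y ∈ E

namespace DownwardIn

variable {V : Type*} [NormedAddCommGroup V] [InnerProductSpace ℝ V]
  {E F : Set V} {c c' n n' : V} {s s' a a' : ℝ}

theorem mono (h : DownwardIn E c s a n) (hb : ball c' s' ⊆ ball c s) : DownwardIn E c' s' a n :=
  fun q hq hqb y hy hqy => h q hq (hb hqb) y (hb hy) hqy

theorem tilt (h : DownwardIn E c s a n) (hn : ‖n - n'‖ ≤ a' - a) : DownwardIn E c s a' n' := by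
  intro q hq hqb y hy hqy
  refine h q hq hqb y hy ?_
  have h1 : inner ℝ (q - y) (n' - n) ≤ ‖q - y‖ * ‖n' - n‖ := real_inner_le_norm _ _
  rw [inner_sub_right, norm_sub_rev n' n] at h1
  nlinarith [norm_nonneg (q - y)]

theorem union (h : DownwardIn E c s a n) (h' : DownwardIn F c s a n) :
    DownwardIn (E ∪ F) c s a n := by
  rintro q (hq | hq) hqb y hy hqy
  · exact Or.inl (h q hq hqb y hy hqy)
  · exact Or.inr (h' q hq hqb y hy hqy)

theorem of_disjoint (h : Disjoint (ball c s) E) : DownwardIn E c s a n :=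
  fun _ hq hqb _ _ _ => (disjoint_left.1 h hqb hq).elim

theorem closure (h : DownwardIn E c s a n) : DownwardIn (closure E) c s a n := by
  intro q hq hqb y hy hqy
  rw [_root_.mem_closure_iff] at hq ⊢
  intro o ho hyo
  have hcont : Continuous fun q' : V => y + (q' - q) := by fun_prop
  have h1 : ∀ᶠ q' in 𝓝 q, y + (q' - q) ∈ o ∩ ball c s ∧ q' ∈ ball c s := by
    refine (hcont.continuousAt.eventually_mem ?_).and (isOpen_ball.mem_nhds hqb)
    simpa using (ho.inter isOpen_ball).mem_nhds ⟨hyo, hy⟩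
  obtain ⟨o', ho', ho'o, hqo⟩ := _root_.eventually_nhds_iff.1 h1
  obtain ⟨q', hq'o, hq'E⟩ := hq o' ho'o hqo
  obtain ⟨⟨h2, h3⟩, h4⟩ := ho' q' hq'o
  refine ⟨_, h2, h q' hq'E h4 _ h3 ?_⟩
  have : q' - (y + (q' - q)) = q - y := by abel
  rwa [this]

theorem mem_of_lt (h : DownwardIn E c s a n) {p y : V} (hp : p ∈ _root_.closure E)
    (hpb : p ∈ ball c s) (hy : y ∈ ball c s) (hpy : a * ‖p - y‖ < inner ℝ (p - y) n) : y ∈ E := by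
  have h1 : ∀ᶠ q in 𝓝 p, q ∈ ball c s ∧ a * ‖q - y‖ < inner ℝ (q - y) n := by
    refine Filter.Eventually.and (isOpen_ball.mem_nhds hpb) ?_
    exact ContinuousAt.eventually_lt (by fun_prop) (by fun_prop) hpy
  obtain ⟨q, ⟨h2, h3⟩, h4⟩ := (h1.and_frequently (mem_closure_iff_frequently.1 hp)).exists
  exact h q h4 h2 y hy h3.le

theorem disjoint_ball_add (h : DownwardIn E c s a n) {z u : V} {r : ℝ}
    (hz : Disjoint (ball z r) E) (hzb : ball z r ⊆ ball c s) (hub : ball (z + u) r ⊆ ball c s)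
    (hu : a * ‖u‖ ≤ inner ℝ u n) : Disjoint (ball (z + u) r) E := by
  rw [disjoint_left] at hz ⊢
  intro q hq hqE
  have hq' : q - u ∈ ball z r := by
    rw [mem_ball_iff_norm] at hq ⊢
    rwa [show q - u - z = q - (z + u) by abel]
  refine hz hq' (h q hqE (hub hq) _ (hzb hq') ?_)
  rwa [sub_sub_cancel]

/-- The cone above a point outside `E` avoids `E`. -/
theorem disjoint_ball_of_notMem (h : DownwardIn E c s a n) {x w : V} {r : ℝ}
    (hx : x ∉ E) (hxb : x ∈ ball c s) (hb : ball (x + w) r ⊆ ball c s) (hn : ‖n‖ = 1)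
    (ha : 0 ≤ a) (hw : a * (‖w‖ + r) ≤ inner ℝ w n - r) : Disjoint (ball (x + w) r) E := by
  rw [disjoint_left]
  intro q hq hqE
  refine hx (h q hqE (hb hq) x hxb ?_)
  rw [mem_ball_iff_norm] at hq
  have e : q - x = w + (q - (x + w)) := by abel
  have h1 := norm_add_le w (q - (x + w))
  have h2 := neg_le_of_abs_le (abs_real_inner_le_norm (q - (x + w)) n)
  rw [hn, mul_one] at h2
  rw [e, inner_add_left]
  nlinarith

/-- A short move from `p` along `n' - n` goes steeply down for `n` and steeply up for `n'`. If the
normals were far apart, it would land in `E` by the first condition, and the second would then put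
`p` itself in the open set `E`. -/
theorem norm_normal_sub_le (hE : IsOpen E) (h : DownwardIn E c s a n) {p : V} {s₁ : ℝ}
    (hp : p ∈ frontier E) (hpb : p ∈ ball c s) (hs₁ : 0 < s₁) (h₁ : DownwardIn E p s₁ a n')
    (hn : ‖n‖ = 1) (hn' : ‖n'‖ = 1) (ha : 0 ≤ a) : ‖n' - n‖ ≤ 2 * a := by
  by_contra! hlt
  have hpE : p ∉ E := fun hpE => (hE.frontier_eq ▸ hp).2 hpE
  have hcont : Continuous fun l : ℝ => p + l • (n' - n) := by fun_prop
  have hev : ∀ᶠ l in 𝓝 (0 : ℝ), p + l • (n' - n) ∈ ball c s ∩ ball p s₁ :=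
    hcont.continuousAt.eventually_mem (by
      simpa using (isOpen_ball.inter isOpen_ball).mem_nhds ⟨hpb, mem_ball_self hs₁⟩)
  obtain ⟨l, ⟨h2, h3⟩, hl⟩ := ((hev.filter_mono nhdsWithin_le_nhds).and
    (self_mem_nhdsWithin : Ioi (0 : ℝ) ∈ 𝓝[>] 0)).exists
  have hnorm : ‖l • (n' - n)‖ = l * ‖n' - n‖ := by rw [norm_smul, Real.norm_of_nonneg hl.le]
  have hpos : 0 < l * ‖n' - n‖ := mul_pos hl (by linarith)
  have hmem : p + l • (n' - n) ∈ E := by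
    refine h.mem_of_lt (frontier_subset_closure hp) hpb h2 ?_
    rw [sub_add_cancel_left, norm_neg, hnorm, inner_neg_left, real_inner_smul_left,
      inner_sub_unit_right hn' hn]
    nlinarith
  refine hpE (h₁ _ hmem h3 p (mem_ball_self hs₁) ?_)
  rw [add_sub_cancel_left, hnorm, real_inner_smul_left, inner_sub_unit_left hn' hn]
  nlinarith

/-- A ball outside `E` that touches `E` at `p` is centred on the normal at `p`. -/
theorem eq_add_smul_of_disjoint_ball {p y : V} {r : ℝ} (hr : 0 < r) (hp : p ∈ _root_.closure E)
    (hn : ‖n‖ = 1) (h : ∀ a > 0, ∃ s > 0, DownwardIn E p s a n) (hyp : dist y p = r)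
    (hd : Disjoint (ball y r) E) : y = p + r • n := by
  set e : V := r⁻¹ • (y - p) with he
  have hy : y = p + r • e := by rw [he, smul_smul, mul_inv_cancel₀ hr.ne', one_smul]; abel
  have he1 : ‖e‖ = 1 := by
    rw [he, norm_smul, ← dist_eq_norm, hyp, norm_inv, Real.norm_of_nonneg hr.le,
      inv_mul_cancel₀ hr.ne']
  by_contra hne
  have hδ : 0 < ‖e - n‖ := by
    rw [norm_pos_iff, sub_ne_zero]; rintro h; exact hne (h ▸ hy)
  -- Moving from `p` along `e - n` enters the ball, whose centre lies in direction `e`. It also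
  -- descends relative to `n` at slope `‖e - n‖ / 2`, hence enters `E` once the cone slope is half
  -- of that.
  obtain ⟨s, hs, hD⟩ := h (‖e - n‖ / 4) (by positivity)
  have hcont : Continuous fun l : ℝ => p + l • (e - n) := by fun_prop
  have hev : ∀ᶠ l in 𝓝 (0 : ℝ), p + l • (e - n) ∈ ball p s ∧ l < r :=
    (hcont.continuousAt.eventually_mem (by simpa using ball_mem_nhds p hs)).and
      (Iio_mem_nhds hr)
  obtain ⟨l, ⟨h2, h3⟩, hl⟩ := ((hev.filter_mono nhdsWithin_le_nhds).and
    (self_mem_nhdsWithin : Ioi (0 : ℝ) ∈ 𝓝[>] 0)).exists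
  have hmem : p + l • (e - n) ∈ E := by
    refine hD.mem_of_lt hp (mem_ball_self hs) h2 ?_
    rw [sub_add_cancel_left, norm_neg, norm_smul, Real.norm_of_nonneg hl.le, inner_neg_left,
      real_inner_smul_left, inner_sub_unit_right he1 hn]
    nlinarith [mul_pos hl (mul_pos hδ hδ)]
  refine disjoint_left.1 hd ?_ hmem
  rw [mem_ball_iff_norm, hy, show p + l • (e - n) - (p + r • e) = l • (e - n) - r • e by abel]
  refine lt_of_pow_lt_pow_left₀ 2 hr.le ?_
  rw [norm_sub_sq_real, norm_smul, norm_smul, he1, Real.norm_of_nonneg hl.le,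
    Real.norm_of_nonneg hr.le, real_inner_smul_left, real_inner_smul_right,
    inner_sub_unit_left he1 hn]
  nlinarith [mul_pos (mul_pos hl (sub_pos.2 h3)) (mul_pos hδ hδ)]

/-- If a ball of radius `r` touches a surface with normal `m` at `p` and avoids `E`, whose normal
`n` differs from `m`, then `p` is at a definite distance from `E`. -/
theorem le_dist_of_disjoint_ball (h : DownwardIn E c s a n) {m p q : V} {r b : ℝ} (hr : 0 < r)
    (hm : ‖m‖ = 1) (hn : ‖n‖ = 1) (hb : 0 ≤ b) (hmn : b ≤ ‖m - n‖) (hab : 2 * a ≤ b)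
    (hd : Disjoint (ball (p + r • m) r) E) (hq : q ∈ E) (hs : ball p (3 * r) ⊆ ball c s) :
    b ^ 2 / 8 * r ≤ dist q p := by
  by_contra! hlt
  -- The shift `w` descends relative to `n`, so it keeps `q` in `E`. It also carries `p` to depth at
  -- least `r * ‖m - n‖ ^ 2 / 8` inside the ball, so a `q` too close to `p` would be carried into
  -- the ball as well.
  set w : V := (r / 2) • (m - n) with hw
  have hδ2 : ‖m - n‖ ≤ 2 := (norm_sub_le m n).trans (by rw [hm, hn]; norm_num)
  have hwn : ‖w‖ = r / 2 * ‖m - n‖ := by rw [hw, norm_smul, Real.norm_of_nonneg (by positivity)]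
  have hb2 : b ^ 2 * r ≤ ‖m - n‖ ^ 2 * r := by gcongr
  have hb4 : ‖m - n‖ ^ 2 * r ≤ 4 * r := by
    gcongr; nlinarith [norm_nonneg (m - n)]
  have hqp : dist q p < r := hlt.trans_le (by linarith)
  have hqb : q ∈ ball p (3 * r) := mem_ball.2 (by linarith)
  have hqw : q + w ∈ ball p (3 * r) := by
    rw [mem_ball_iff_norm, show q + w - p = (q - p) + w by abel]
    rw [dist_eq_norm] at hqp
    refine (norm_add_le _ _).trans_lt ?_
    rw [hwn]; nlinarith
  have hmem : q + w ∈ E := by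
    refine h q hq (hs hqb) _ (hs hqw) ?_
    rw [sub_add_cancel_left, norm_neg, hwn, inner_neg_left, hw, real_inner_smul_left,
      inner_sub_unit_right hm hn]
    nlinarith [mul_nonneg hr.le (norm_nonneg (m - n))]
  refine disjoint_left.1 hd ?_ hmem
  rw [mem_ball_iff_norm, show q + w - (p + r • m) = (q - p) + (w - r • m) by abel]
  have h1 : ‖w - r • m‖ ≤ r * (1 - ‖m - n‖ ^ 2 / 8) := by
    refine le_of_sq_le_sq ?_ (mul_nonneg hr.le (by nlinarith [norm_nonneg (m - n)]))
    rw [norm_sub_sq_real, hwn, hw, norm_smul, hm, Real.norm_of_nonneg hr.le, real_inner_smul_left,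
      real_inner_smul_right, inner_sub_unit_left hm hn]
    nlinarith [mul_nonneg (mul_nonneg hr.le hr.le) (pow_nonneg (norm_nonneg (m - n)) 4)]
  rw [dist_eq_norm] at hlt
  refine (norm_add_le _ _).trans_lt ?_
  linarith

end DownwardIn

/-! ### From Hölder graphs to normals. -/

theorem norm_fderiv_le_of_normC1Holder_le {r α M : ℝ} {φ : Euc2 → ℝ} (hr : 0 < r) (hM : 0 ≤ M)
    (hφ : fderiv ℝ φ 0 = 0) (h : normC1Holder r α φ ≤ ENNReal.ofReal (M * r))
    {x : Euc2} (hx : x ∈ ball (0 : Euc2) r) : ‖fderiv ℝ φ x‖ ≤ M * (‖x‖ / r) ^ α := by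
  rcases eq_or_ne x 0 with rfl | hx0
  · rw [hφ, norm_zero]; positivity
  have hxn : 0 < ‖x‖ := norm_pos_iff.2 hx0
  have h1 : ENNReal.ofReal (r ^ (1 + α)) * ENNReal.ofReal
      (‖fderiv ℝ φ x - fderiv ℝ φ 0‖ / ‖x - 0‖ ^ α) ≤ ENNReal.ofReal (M * r) := by
    refine le_trans ?_ h
    unfold normC1Holder
    refine le_trans ?_ le_add_self
    gcongr
    exact le_iSup₂_of_le x hx (le_iSup₂_of_le 0 (mem_ball_self hr) (le_iSup_of_le hx0 le_rfl))
  rw [hφ, sub_zero, sub_zero, ← ENNReal.ofReal_mul (by positivity),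
    ENNReal.ofReal_le_ofReal_iff (by positivity), Real.rpow_add hr, Real.rpow_one] at h1
  have h2 : 0 < ‖x‖ ^ α := Real.rpow_pos_of_pos hxn α
  have h3 : 0 < r ^ α := Real.rpow_pos_of_pos hr α
  rw [Real.div_rpow hxn.le hr.le, mul_div_assoc', le_div_iff₀ h3]
  rw [mul_div_assoc', div_le_iff₀ h2] at h1
  nlinarith

theorem norm_horizontal_le (x : Euc3) : ‖(!₂[x 0, x 1] : Euc2)‖ ≤ ‖x‖ := by
  rw [EuclideanSpace.norm_eq, EuclideanSpace.norm_eq]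
  apply Real.sqrt_le_sqrt
  simp only [Fin.sum_univ_three, Fin.sum_univ_two]
  simpa using sq_nonneg (x 2)

/-- The gradient vanishes at the centre and is Hölder, so on the ball of radius `s` the graph has
Lipschitz constant at most `M₀ * (s / ρ₀) ^ α`. The same normal serves every scale, and the slope
tends to 0 with `s`. -/
theorem IsOfClassC1Holder.exists_normal {α ρ₀ M₀ : ℝ} {E : Set Euc3}
    (h : IsOfClassC1Holder α ρ₀ M₀ E) (hα : 0 < α) (hρ : 0 < ρ₀) (hM : 0 ≤ M₀) {P : Euc3}
    (hP : P ∈ frontier E) : ∃ n : Euc3, ‖n‖ = 1 ∧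
      ∀ s a : ℝ, s ≤ ρ₀ → M₀ * (s / ρ₀) ^ α ≤ a → DownwardIn E P s a n := by
  obtain ⟨T, φ, hT, hE, hφ, -, hφ', hnorm⟩ := h P hP
  set e : Euc3 := EuclideanSpace.single 2 1 with he
  -- The set lies above its graph, so the outer normal is the downward vertical.
  refine ⟨T.linearIsometryEquiv.symm (-e), by simp [he], fun s a hs ha => ?_⟩
  have hball : ∀ x : Euc3, x ∈ ball P s → T x ∈ ball (0 : Euc3) s := by
    intro x hx
    rw [mem_ball, ← hT, T.dist_map]; exact hx
  have hmemE : ∀ x ∈ ball P s, (x ∈ E ↔ φ !₂[T x 0, T x 1] < T x 2) := by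
    intro x hx
    have hx' := ball_subset_ball hs (hball x hx)
    have := Set.ext_iff.1 hE (T x)
    rw [mem_inter_iff, mem_ofPred_eq, T.injective.mem_set_image] at this
    tauto
  have hhor : ∀ x ∈ ball P s, (!₂[T x 0, T x 1] : Euc2) ∈ ball (0 : Euc2) s := by
    intro x hx
    have := hball x hx
    rw [mem_ball_zero_iff] at this ⊢
    exact (norm_horizontal_le _).trans_lt this
  intro q hq hqb y hy hqy
  have ha0 : 0 ≤ a := by
    have : 0 < s := pos_of_mem_ball hy
    exact le_trans (by positivity) ha
  have hmv : ‖φ !₂[T y 0, T y 1] - φ !₂[T q 0, T q 1]‖ ≤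
      a * ‖(!₂[T y 0, T y 1] : Euc2) - !₂[T q 0, T q 1]‖ := by
    refine (convex_ball (0 : Euc2) s).norm_image_sub_le_of_norm_fderiv_le (𝕜 := ℝ) ?_ ?_
      (hhor q hqb) (hhor y hy)
    · intro x hx
      exact (hφ.differentiableOn one_ne_zero).differentiableAt
        (isOpen_ball.mem_nhds (ball_subset_ball hs hx))
    · intro x hx
      refine (norm_fderiv_le_of_normC1Holder_le hρ hM hφ' hnorm
        (ball_subset_ball hs hx)).trans (le_trans ?_ ha)
      rw [mem_ball_zero_iff] at hx
      gcongr
  have hle : ‖(!₂[T y 0, T y 1] : Euc2) - !₂[T q 0, T q 1]‖ ≤ ‖q - y‖ := by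
    have h1 := norm_horizontal_le (T y - T q)
    rw [← dist_eq_norm (T y), T.dist_map, dist_comm, dist_eq_norm] at h1
    convert h1 using 2
    ext i; fin_cases i <;> simp
  have hin : inner ℝ (q - y) (T.linearIsometryEquiv.symm (-e)) = T y 2 - T q 2 := by
    rw [← T.linearIsometryEquiv.inner_map_map, LinearIsometryEquiv.apply_symm_apply,
      ← vsub_eq_sub, T.map_vsub, vsub_eq_sub, inner_neg_right, he,
      EuclideanSpace.inner_single_right]
    simp
  rw [hin] at hqy
  rw [hmemE q hqb] at hq
  rw [hmemE y hy]
  have h1 := (le_abs_self _).trans hmv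
  nlinarith [mul_le_mul_of_nonneg_left hle ha0]

theorem exists_pos_mul_rpow_le {α M₀ a : ℝ} (hα : 0 < α) (hM : 0 < M₀) (ha : 0 < a) :
    ∃ σ : ℝ, 0 < σ ∧ σ ≤ 1 ∧ M₀ * σ ^ α ≤ a := by
  refine ⟨min 1 ((a / M₀) ^ α⁻¹), by positivity, min_le_left _ _, ?_⟩
  calc M₀ * (min 1 ((a / M₀) ^ α⁻¹)) ^ α ≤ M₀ * ((a / M₀) ^ α⁻¹) ^ α := by
        gcongr; exact min_le_right _ _
    _ = a := by
        rw [← Real.rpow_mul (by positivity), inv_mul_cancel₀ hα.ne', Real.rpow_one]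
        field_simp

theorem isOuterUnitNormal_of_downwardIn {E : Set Euc3} {P n : Euc3} (hE : IsOpen E)
    (hP : P ∈ frontier E) (hn : ‖n‖ = 1) (h : ∀ a > 0, ∃ s > 0, DownwardIn E P s a n) :
    IsOuterUnitNormal E P n := by
  refine ⟨hP, hn, fun a ha => ?_⟩
  obtain ⟨s, hs, hD⟩ := h a ha
  filter_upwards [ball_mem_nhds P hs] with x hx
  constructor
  · intro hlt
    refine hD.mem_of_lt (frontier_subset_closure hP) (mem_ball_self hs) hx ?_
    rw [← neg_sub x P, norm_neg, inner_neg_left]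
    linarith
  · intro hlt hxE
    exact (hE.frontier_eq ▸ hP).2 (hD x hxE hx P (mem_ball_self hs) hlt.le)

theorem DownwardIn.ball_subset {V : Type*} [NormedAddCommGroup V] [InnerProductSpace ℝ V]
    {E : Set V} {p n : V} {s a : ℝ} (h : DownwardIn E p s a n) (hs : 0 < s)
    (hp : p ∈ _root_.closure E) (hn : ‖n‖ = 1) (ha : a ≤ 1 / 2) :
    ball (p - (s / 2) • n) (s / 8) ⊆ E := by
  intro y hy
  rw [mem_ball_iff_norm] at hy
  set e := y - (p - (s / 2) • n) with he
  have e1 : p - y = (s / 2) • n - e := by rw [he]; abel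
  have h1 : ‖p - y‖ ≤ s / 2 + s / 8 := by
    rw [e1]
    refine (norm_sub_le _ _).trans ?_
    rw [norm_smul, hn, Real.norm_of_nonneg (by positivity)]
    linarith
  refine h.mem_of_lt hp (mem_ball_self hs) ?_ ?_
  · rw [mem_ball_iff_norm, norm_sub_rev]; linarith
  · have h2 := real_inner_le_norm e n
    rw [hn, mul_one] at h2
    have h3 : inner ℝ (p - y) n = s / 2 - inner ℝ e n := by
      rw [e1, inner_sub_left, real_inner_smul_left, real_inner_self_eq_norm_sq, hn]; ring
    rw [h3]
    nlinarith [norm_nonneg (p - y)]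

/-! ### Moving clear balls. -/

section Reach

variable {V : Type*} [NormedAddCommGroup V] [InnerProductSpace ℝ V]

/-- The points of `O` that are centres of balls of radius `d` avoiding `F`. -/
def clearCenters (F O : Set V) (d : ℝ) : Set V := {z | z ∈ O ∧ Disjoint (ball z d) F}

theorem joinedIn_add_of_forall {N : Set V} {z u : V}
    (h : ∀ t ∈ Icc (0 : ℝ) 1, z + t • u ∈ N) : JoinedIn N z (z + u) := by
  refine JoinedIn.of_segment_subset ?_
  rw [segment_eq_image']
  rintro _ ⟨t, ht, rfl⟩
  simpa using h t ht

theorem DownwardIn.disjoint_ball_add_smul {F : Set V} {x n : V} {d a t : ℝ}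
    (h : DownwardIn F x (30 * d) a n) (hd : 0 < d) (ha₀ : 0 ≤ a) (ha : a ≤ 1 / 2) (hn : ‖n‖ = 1)
    (hx : x ∉ F) (ht : 3 * d ≤ t) (ht' : t ≤ 29 * d) : Disjoint (ball (x + t • n) d) F := by
  have htn : ‖t • n‖ = t := by rw [norm_smul, hn, mul_one, Real.norm_of_nonneg (by linarith)]
  refine h.disjoint_ball_of_notMem hx (mem_ball_self (by linarith)) ?_ hn ha₀ ?_
  · refine ball_subset_ball' ?_
    rw [dist_eq_norm, add_sub_cancel_left, htn]; linarith
  · rw [htn, real_inner_smul_left, real_inner_self_eq_norm_sq, hn]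
    nlinarith

/-- Both balls are raised by `20 * d` along `n`, which the cone condition allows. At that height
every centre within `5 * d` of the axis point is clear, because `x ∉ F` keeps the cone above `x`
free, so the raised centres are joined by a segment. Everything stays within `30 * d` of `x`. -/
theorem DownwardIn.joinedIn_clearCenters {F O : Set V} {x n z z' : V} {d a : ℝ}
    (h : DownwardIn F x (30 * d) a n) (hd : 0 < d) (ha₀ : 0 ≤ a) (ha : a ≤ 1 / 2) (hn : ‖n‖ = 1)
    (hx : x ∉ F) (hO : ball x (30 * d) ⊆ O) (hz : z ∈ ball x (5 * d)) (hz' : z' ∈ ball x (5 * d))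
    (hzF : Disjoint (ball z d) F) (hzF' : Disjoint (ball z' d) F) :
    JoinedIn (clearCenters F O d) z z' := by
  have up : ∀ y ∈ ball x (5 * d), Disjoint (ball y d) F →
      JoinedIn (clearCenters F O d) y (y + (20 * d) • n) := by
    intro y hy hyF
    rw [mem_ball_iff_norm] at hy
    refine joinedIn_add_of_forall fun t ht => ?_
    have htn : ‖t • (20 * d) • n‖ ≤ 20 * d := by
      rw [norm_smul, norm_smul, hn, Real.norm_of_nonneg ht.1, Real.norm_of_nonneg (by positivity)]
      nlinarith [ht.2]
    have hdist : dist (y + t • (20 * d) • n) x ≤ 25 * d := by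
      rw [dist_eq_norm, show y + t • (20 * d) • n - x = (y - x) + t • (20 * d) • n by abel]
      exact (norm_add_le _ _).trans (by linarith)
    refine ⟨hO (mem_ball.2 (by linarith)), h.disjoint_ball_add hyF ?_ ?_ ?_⟩
    · exact ball_subset_ball' (by rw [dist_eq_norm]; linarith)
    · exact ball_subset_ball' (by linarith)
    · rw [smul_smul, norm_smul, real_inner_smul_left, real_inner_self_eq_norm_sq, hn,
        Real.norm_of_nonneg (mul_nonneg ht.1 (by positivity))]
      nlinarith [mul_nonneg ht.1 hd.le]
  have across : JoinedIn (clearCenters F O d) (z + (20 * d) • n) (z' + (20 * d) • n) := by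
    have hsub : ball (x + (20 * d) • n) (5 * d) ⊆ clearCenters F O d := by
      intro y hy
      rw [mem_ball_iff_norm] at hy
      set e := y - (x + (20 * d) • n) with he
      have e1 : y = x + ((20 * d) • n + e) := by rw [he]; abel
      have hnn : ‖(20 * d) • n‖ = 20 * d := by
        rw [norm_smul, hn, Real.norm_of_nonneg (by positivity), mul_one]
      have hw : ‖(20 * d) • n + e‖ ≤ 25 * d := (norm_add_le _ _).trans (by linarith)
      have hyx : dist y x ≤ 25 * d := by rwa [e1, dist_eq_norm, add_sub_cancel_left]
      refine ⟨hO (mem_ball.2 (by linarith)), ?_⟩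
      have h2 := neg_le_of_abs_le (abs_real_inner_le_norm e n)
      rw [hn, mul_one] at h2
      rw [e1]
      refine h.disjoint_ball_of_notMem hx (mem_ball_self (by linarith)) ?_ hn ha₀ ?_
      · rw [← e1]; exact ball_subset_ball' (by linarith)
      · rw [inner_add_left, real_inner_smul_left, real_inner_self_eq_norm_sq, hn]
        nlinarith [norm_nonneg ((20 * d) • n + e)]
    refine ((convex_ball _ _).isPathConnected ⟨z + (20 * d) • n, ?_⟩).joinedIn _ ?_ _ ?_ |>.mono hsub
    all_goals
      rw [mem_ball_iff_norm] at *
      rwa [add_sub_add_right_eq_sub]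
  exact ((up z hz hzF).trans across).trans (up z' hz' hzF').symm

/-- Continuation: the points within `4 * d` of a reached centre form an open set, and it is
relatively closed in `H`. A limit point has a reached centre within `5 * d`, which can be moved to
height `3 * d` above that point. The cone condition is asked only near centres already reached,
since only there can alignment of normals be proved. -/
theorem IsPreconnected.exists_joinedIn_clearCenters {F O H : Set V} {z₀ : V} {d a : ℝ}
    (hH : IsPreconnected H) (hd : 0 < d) (ha₀ : 0 ≤ a) (ha : a ≤ 1 / 2)
    (hHF : ∀ x ∈ H, x ∉ F) (hO : ∀ x ∈ H, ball x (30 * d) ⊆ O)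
    (hloc : ∀ x ∈ H, (∃ z ∈ ball x (5 * d), JoinedIn (clearCenters F O d) z₀ z) →
      ∃ n, ‖n‖ = 1 ∧ DownwardIn F x (30 * d) a n)
    {x₀ : V} (hx₀ : x₀ ∈ H) (h₀ : ∃ z ∈ ball x₀ (4 * d), JoinedIn (clearCenters F O d) z₀ z) :
    ∀ x ∈ H, ∃ z ∈ ball x (4 * d), JoinedIn (clearCenters F O d) z₀ z := by
  set A : Set V := ⋃ z ∈ {z | JoinedIn (clearCenters F O d) z₀ z}, ball z (4 * d) with hA
  have hAmem : ∀ x, x ∈ A ↔ ∃ z ∈ ball x (4 * d), JoinedIn (clearCenters F O d) z₀ z := by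
    intro x
    simp only [hA, mem_iUnion, mem_ofPred_eq, exists_prop, mem_ball_comm (x := x)]
    exact exists_congr fun z => and_comm
  have hAo : IsOpen A := isOpen_biUnion fun _ _ => isOpen_ball
  intro x hx
  rw [← hAmem]
  refine hH.subset_of_closure_inter_subset hAo ⟨x₀, hx₀, (hAmem x₀).2 h₀⟩ ?_ hx
  rintro y ⟨hyA, hyH⟩
  obtain ⟨y', hy'A, hyy'⟩ := Metric.mem_closure_iff.1 hyA d hd
  obtain ⟨z, hz, hzJ⟩ := (hAmem y').1 hy'A
  have hz5 : z ∈ ball y (5 * d) := by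
    rw [mem_ball] at *
    have := dist_triangle z y' y
    rw [dist_comm y' y] at this
    linarith
  obtain ⟨n, hn, hD⟩ := hloc y hyH ⟨z, hz5, hzJ⟩
  have hyF := hHF y hyH
  have hy3 : ∀ r, 3 * d < r → y + (3 * d) • n ∈ ball y r := by
    intro r hr
    rw [mem_ball_iff_norm, add_sub_cancel_left, norm_smul, hn, Real.norm_of_nonneg (by positivity)]
    linarith
  refine (hAmem y).2 ⟨y + (3 * d) • n, hy3 _ (by linarith), hzJ.trans ?_⟩
  exact hD.joinedIn_clearCenters hd ha₀ ha hn hyF (hO y hyH) hz5 (hy3 _ (by linarith))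
    hzJ.target_mem.2 (hD.disjoint_ball_add_smul hd ha₀ ha hn hyF le_rfl (by linarith))

/-- Between two surfaces with different normals, a ball can be moved away from the second until
it touches the first. -/
theorem exists_touching_ball [ProperSpace V] {D₁ D₂ : Set V} {c p₁ p₂ n₁ n₂ z : V} {d a s : ℝ}
    (hD₁ : IsOpen D₁) (hd : 0 < d) (ha₀ : 0 < a) (ha : a ≤ 1 / 2) (hs : 1000 * d ≤ a * s)
    (hp₁ : p₁ ∈ closure D₁) (hp₁c : p₁ ∈ ball c (30 * d)) (hp₂c : p₂ ∈ ball c (30 * d))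
    (hzc : z ∈ ball c (30 * d)) (hz₁ : Disjoint (ball z d) D₁) (hz₂ : Disjoint (ball z d) D₂)
    (hn₁ : ‖n₁‖ = 1) (hn₂ : ‖n₂‖ = 1)
    (h₁ : DownwardIn D₁ p₁ s (a / 8) n₁) (h₂ : DownwardIn D₂ p₂ s (a / 8) n₂)
    (hn : a / 2 ≤ ‖n₂ - n₁‖) :
    ∃ u : V, a * ‖u‖ ≤ 600 * d ∧ (∀ t ∈ Icc (0 : ℝ) 1, Disjoint (ball (z + t • u) d) (D₁ ∪ D₂)) ∧
      ∃ P ∈ frontier D₁, dist (z + u) P = d := by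
  set δ := ‖n₂ - n₁‖ with hδ
  have hδ0 : 0 < δ := by linarith
  -- The unit direction `v` rises from `D₂` and sinks into `D₁`, with slope `δ / 2 ≥ a / 4` in both
  -- cases, which beats the cone slope `a / 8`.
  set v : V := δ⁻¹ • (n₂ - n₁) with hv
  have hv1 : ‖v‖ = 1 := by
    rw [hv, norm_smul, norm_inv, Real.norm_of_nonneg hδ0.le, ← hδ, inv_mul_cancel₀ hδ0.ne']
  have hv2 : inner ℝ v n₂ = δ / 2 := by
    rw [hv, real_inner_smul_left, inner_sub_unit_left hn₂ hn₁, ← hδ]; field_simp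
  have hv1' : inner ℝ v n₁ = -(δ / 2) := by
    rw [hv, real_inner_smul_left, inner_sub_unit_right hn₂ hn₁, ← hδ]; field_simp
  set B := d / a with hB
  have hBa : B * a = d := by rw [hB]; field_simp
  have hB0 : 0 < B := by positivity
  have hdB : 2 * d ≤ B := by nlinarith
  have hsB : 1000 * B ≤ s := by
    have : a * (1000 * B) ≤ a * s := by linarith
    exact le_of_mul_le_mul_left this ha₀
  have hpz : ∀ p ∈ ball c (30 * d), dist z p < 60 * d := by
    intro p hp
    rw [mem_ball] at hp hzc
    have := dist_triangle_right z p c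
    linarith
  have htv : ∀ t : ℝ, 0 ≤ t → ‖t • v‖ = t := fun t ht => by
    rw [norm_smul, hv1, Real.norm_of_nonneg ht, mul_one]
  have hdist : ∀ p ∈ ball c (30 * d), ∀ t, 0 ≤ t → t ≤ 600 * B → dist (z + t • v) p < 700 * B := by
    intro p hp t ht ht'
    have h3 := dist_triangle (z + t • v) z p
    rw [dist_eq_norm (z + t • v) z, add_sub_cancel_left, htv t ht] at h3
    linarith [hpz p hp]
  have hsub : ∀ p ∈ ball c (30 * d), ∀ t, 0 ≤ t → t ≤ 600 * B →
      ball (z + t • v) (2 * d) ⊆ ball p s := by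
    intro p hp t ht ht'
    exact ball_subset_ball' (by linarith [hdist p hp t ht ht'])
  have hd2 : ∀ y : V, ball y d ⊆ ball y (2 * d) := fun y => ball_subset_ball (by linarith)
  -- A descent of at least `150 * d` along `v` beats the initial offset `60 * d` plus the cone loss,
  -- which is below `79 * d`.
  have hend : z + (600 * B) • v ∈ D₁ := by
    refine h₁.mem_of_lt hp₁ (mem_ball_self (by linarith))
      (hsub p₁ hp₁c _ (by positivity) le_rfl (mem_ball_self (by positivity))) ?_
    have e1 : p₁ - (z + (600 * B) • v) = (p₁ - z) - (600 * B) • v := by abel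
    have hpz1 : ‖p₁ - z‖ < 60 * d := by
      rw [← dist_eq_norm, dist_comm]; exact hpz p₁ hp₁c
    have h3 : ‖p₁ - (z + (600 * B) • v)‖ ≤ 60 * d + 600 * B := by
      rw [e1]
      refine (norm_sub_le _ _).trans ?_
      rw [htv _ (by positivity)]; linarith
    have h4 := neg_le_of_abs_le (abs_real_inner_le_norm (p₁ - z) n₁)
    rw [hn₁, mul_one] at h4
    have h5 : inner ℝ (p₁ - (z + (600 * B) • v)) n₁ =
        inner ℝ (p₁ - z) n₁ + 600 * B * (δ / 2) := by
      rw [e1, inner_sub_left, real_inner_smul_left, hv1']; ring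
    rw [h5]
    have h6 : a / 8 * ‖p₁ - (z + (600 * B) • v)‖ ≤ a / 8 * (60 * d + 600 * B) := by gcongr
    have h7 : 600 * B * (a / 2 / 2) ≤ 600 * B * (δ / 2) := by gcongr
    nlinarith
  have hneD : D₁.Nonempty := ⟨_, hend⟩
  set f : ℝ → ℝ := fun t => infDist (z + t • v) D₁
  have hf : ContinuousOn f (Icc 0 (600 * B)) := by
    have : Continuous f := (continuous_infDist_pt D₁).comp (by fun_prop)
    exact this.continuousOn
  obtain ⟨t, ⟨ht0, htB⟩, htd⟩ := intermediate_value_Icc' (by positivity) hf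
    (show d ∈ Icc (f (600 * B)) (f 0) from
      ⟨by simp only [f, infDist_zero_of_mem hend]; exact hd.le, by
        simp only [f, zero_smul, add_zero]
        exact (le_infDist hneD).2 fun {y} hy => not_lt.1 fun hlt =>
          disjoint_left.1 hz₁ (mem_ball'.2 hlt) hy⟩)
  have hdis1 : Disjoint (ball (z + t • v) d) D₁ := by
    rw [disjoint_left]
    intro y hy hyD
    have := infDist_le_dist_of_mem (x := z + t • v) hyD
    rw [mem_ball'] at hy
    simp only [f] at htd
    linarith
  refine ⟨t • v, ?_, ?_, ?_⟩
  · rw [htv t ht0]; nlinarith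
  · intro τ hτ
    rw [smul_smul]
    have hτt0 : 0 ≤ τ * t := mul_nonneg hτ.1 ht0
    have hτt : τ * t ≤ t := mul_le_of_le_one_left ht0 hτ.2
    rw [disjoint_union_right]
    constructor
    -- If an earlier ball met `D₁`, sliding the common point along `v` would keep it in `D₁` and
    -- bring it into the final ball.
    · rw [disjoint_left]
      intro q hq hqD
      have hq' : q + (t - τ * t) • v ∈ ball (z + t • v) d := by
        rw [mem_ball_iff_norm] at hq ⊢
        rwa [show q + (t - τ * t) • v - (z + t • v) = q - (z + (τ * t) • v) by module]
      refine disjoint_left.1 hdis1 hq' (h₁ q hqD ?_ _ ?_ ?_)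
      · exact hsub p₁ hp₁c _ hτt0 (hτt.trans htB) (hd2 _ hq)
      · exact hsub p₁ hp₁c _ ht0 htB (hd2 _ hq')
      · rw [sub_add_cancel_left, norm_neg, htv _ (by linarith), inner_neg_left,
          real_inner_smul_left, hv1']
        nlinarith
    · refine h₂.disjoint_ball_add hz₂ ?_ ?_ ?_
      · have := hsub p₂ hp₂c 0 le_rfl (by positivity)
        rw [zero_smul, add_zero] at this
        exact (hd2 _).trans this
      · exact (hd2 _).trans (hsub p₂ hp₂c _ hτt0 (hτt.trans htB))
      · rw [htv _ hτt0, real_inner_smul_left, hv2]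
        nlinarith
  · obtain ⟨P, hP, hPd⟩ := isClosed_closure.exists_infDist_eq_dist hneD.closure (z + t • v)
    rw [infDist_closure] at hPd
    have hPd' : dist (z + t • v) P = d := hPd.symm.trans htd
    refine ⟨P, ?_, hPd'⟩
    rw [hD₁.frontier_eq]
    refine ⟨hP, fun hPD => ?_⟩
    have h8 : P ∈ closure (ball (z + t • v) d) := by
      rw [closure_ball _ hd.ne', mem_closedBall']; exact hPd'.le
    obtain ⟨y, hyD, hyb⟩ := _root_.mem_closure_iff.1 h8 D₁ hD₁ hPD
    exact disjoint_left.1 hdis1 hyb hyD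

end Reach

/-! ### Diameter bound from volume. -/

/-- A connected set that contains a ball of fixed radius near each of its points has diameter
bounded in terms of its volume. -/
theorem dist_le_of_volume_le {Ω : Set Euc3} (hΩ : IsPreconnected Ω) {s m : ℝ} (hs : 0 < s)
    (hm : 0 ≤ m) (hball : ∀ x ∈ Ω, ∃ y, dist y x ≤ s ∧ ball y (s / 8) ⊆ Ω)
    (hvol : volume Ω ≤ ENNReal.ofReal m) {a b : Euc3} (ha : a ∈ Ω) (hb : b ∈ Ω) :
    dist a b ≤ 3 * s * (m / ((s / 8) ^ 3 * (volume (ball (0 : Euc3) 1)).toReal) + 1) := by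
  set v := (volume (ball (0 : Euc3) 1)).toReal with hv
  have hvtop : volume (ball (0 : Euc3) 1) ≠ ⊤ := measure_ball_lt_top.ne
  have hv0 : 0 < v := ENNReal.toReal_pos (measure_ball_pos volume _ one_pos).ne' hvtop
  set J := ⌊dist a b / (3 * s)⌋₊ with hJ
  have hJle : (J : ℝ) * (3 * s) ≤ dist a b :=
    (le_div_iff₀ (by positivity)).1 (Nat.floor_le (by positivity))
  have hJlt : dist a b < (J + 1) * (3 * s) :=
    (div_lt_iff₀ (by positivity)).1 (Nat.lt_floor_add_one _)
  -- By connectedness `Ω` meets each sphere about `a` of radius `3 * s * j`. The associated balls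
  -- have centres within `s` of these spheres, so they are disjoint and the volume bounds their
  -- number.
  have hx : ∀ j ∈ Finset.range J, ∃ y, |dist a y - 3 * s * j| ≤ s ∧ ball y (s / 8) ⊆ Ω := by
    intro j hj
    have hjJ : (j : ℝ) ≤ J := by exact_mod_cast (Finset.mem_range.1 hj).le
    obtain ⟨x, hx, hxa⟩ := hΩ.intermediate_value ha hb
      (f := fun x => dist a x) (by fun_prop : Continuous fun x => dist a x).continuousOn
      (show 3 * s * j ∈ Icc (dist a a) (dist a b) from
        ⟨by rw [dist_self]; positivity, by nlinarith⟩)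
    obtain ⟨y, hyx, hy⟩ := hball x hx
    refine ⟨y, ?_, hy⟩
    rw [← hxa]
    simp only [dist_comm a]
    exact (abs_dist_sub_le y x a).trans hyx
  choose! y hy hyΩ using hx
  have hdisj : (Finset.range J : Set ℕ).PairwiseDisjoint fun j => ball (y j) (s / 8) := by
    intro i hi j hj hij
    have h1 := abs_le.1 (hy i hi)
    have h2 := abs_le.1 (hy j hj)
    refine ball_disjoint_ball ?_
    have h3 := abs_le.1 (abs_dist_sub_le (y i) (y j) a)
    rw [dist_comm _ a, dist_comm _ a] at h3
    rcases lt_or_gt_of_ne hij with h | h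
    · have : (i : ℝ) + 1 ≤ j := by exact_mod_cast h
      nlinarith
    · have : (j : ℝ) + 1 ≤ i := by exact_mod_cast h
      nlinarith
  have hsum : ∑ j ∈ Finset.range J, volume (ball (y j) (s / 8)) ≤ volume Ω := by
    rw [← measure_biUnion_finset hdisj fun _ _ => measurableSet_ball]
    exact measure_mono (iUnion₂_subset fun j hj => hyΩ j hj)
  have hterm : ∀ j, volume (ball (y j) (s / 8)) = ENNReal.ofReal ((s / 8) ^ 3 * v) := by
    intro j
    rw [Measure.addHaar_ball _ _ (by positivity), finrank_euclideanSpace_fin,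
      ENNReal.ofReal_mul (by positivity), hv, ENNReal.ofReal_toReal hvtop]
  have hJm : (J : ℝ) * ((s / 8) ^ 3 * v) ≤ m := by
    rw [← ENNReal.ofReal_le_ofReal_iff hm]
    refine le_trans (le_of_eq ?_) (hsum.trans hvol)
    simp only [hterm, Finset.sum_const, Finset.card_range, nsmul_eq_mul]
    rw [ENNReal.ofReal_mul (by positivity), ENNReal.ofReal_natCast]
  have hJm' : (J : ℝ) ≤ m / ((s / 8) ^ 3 * v) := (le_div_iff₀ (by positivity)).2 hJm
  nlinarith

theorem IsPreconnected.inter_frontier_nonempty {X : Type*} [TopologicalSpace X] {S E : Set X}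
    (hS : IsPreconnected S) (h : (S ∩ E).Nonempty) (h' : (S ∩ Eᶜ).Nonempty) :
    (S ∩ frontier E).Nonempty := by
  by_contra! hempty
  have hfr : ∀ x ∈ S, x ∉ frontier E := fun x hx hxE => hempty.subset ⟨hx, hxE⟩
  obtain ⟨x, hxS, hxE⟩ := h
  obtain ⟨y, hyS, hyE⟩ := h'
  obtain ⟨z, -, hz, hz'⟩ := hS (interior E) (closure E)ᶜ isOpen_interior
    isClosed_closure.isOpen_compl
    (fun z hz => or_iff_not_imp_left.2 fun h hc => hfr z hz ⟨hc, h⟩)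
    ⟨x, hxS, by_contra fun h => hfr x hxS ⟨subset_closure hxE, h⟩⟩
    ⟨y, hyS, fun hc => hfr y hyS ⟨hc, fun h => hyE (interior_subset h)⟩⟩
  exact hz' (subset_closure (interior_subset hz))

/-- Either the ball about `x` already fits, or a frontier point lies within `s / 8` of `x` and the
ball is taken at depth `s / 2` below it. -/
theorem exists_ball_subset_of_downwardIn {E : Set Euc3} {s a : ℝ} (hs : 0 < s) (ha : a ≤ 1 / 2)
    (h : ∀ p ∈ frontier E, ∃ n, ‖n‖ = 1 ∧ DownwardIn E p s a n) {x : Euc3} (hx : x ∈ E) :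
    ∃ y, dist y x ≤ s ∧ ball y (s / 8) ⊆ E := by
  by_cases hsub : ball x (s / 8) ⊆ E
  · exact ⟨x, by rw [dist_self]; exact hs.le, hsub⟩
  obtain ⟨q, hq, hqE⟩ := not_subset.1 hsub
  obtain ⟨p, hpb, hp⟩ : (ball x (s / 8) ∩ frontier E).Nonempty :=
    (convex_ball x (s / 8)).isPreconnected.inter_frontier_nonempty
      ⟨x, mem_ball_self (by positivity), hx⟩ ⟨q, hq, hqE⟩
  obtain ⟨n, hn, hD⟩ := h p hp
  refine ⟨p - (s / 2) • n, ?_, hD.ball_subset hs (frontier_subset_closure hp) hn ha⟩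
  have h1 := dist_triangle (p - (s / 2) • n) p x
  rw [dist_eq_norm (p - (s / 2) • n) p, sub_sub_cancel_left, norm_neg, norm_smul, hn,
    Real.norm_of_nonneg (by positivity)] at h1
  rw [mem_ball] at hpb
  linarith

/-! ### The exterior component and the filled union. -/

section Exterior

variable {Ω D₁ D₂ : Set Euc3}

theorem isOpen_exteriorComponent : IsOpen (exteriorComponent Ω D₁ D₂) :=
  isOpen_biUnion fun _ _ => isClosed_closure.isOpen_compl.connectedComponentIn

theorem compl_filledUnion : (filledUnion Ω D₁ D₂)ᶜ = closure (exteriorComponent Ω D₁ D₂) :=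
  compl_compl _

theorem exteriorComponent_subset : exteriorComponent Ω D₁ D₂ ⊆ (closure (D₁ ∪ D₂))ᶜ :=
  iUnion₂_subset fun _ _ => connectedComponentIn_subset _ _

theorem closure_compl_subset (h₁ : D₁ ⊆ Ω) (h₂ : D₂ ⊆ Ω) :
    (closure Ω)ᶜ ⊆ (closure (D₁ ∪ D₂))ᶜ :=
  compl_subset_compl.2 (closure_mono (union_subset h₁ h₂))

theorem compl_subset_exteriorComponent (h₁ : D₁ ⊆ Ω) (h₂ : D₂ ⊆ Ω) :
    (closure Ω)ᶜ ⊆ exteriorComponent Ω D₁ D₂ := fun _ hx =>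
  mem_biUnion hx (mem_connectedComponentIn (closure_compl_subset h₁ h₂ hx))

theorem exteriorComponent_eq (h₁ : D₁ ⊆ Ω) (h₂ : D₂ ⊆ Ω) (hΩ : IsPreconnected (closure Ω)ᶜ)
    {x : Euc3} (hx : x ∈ exteriorComponent Ω D₁ D₂) :
    exteriorComponent Ω D₁ D₂ = connectedComponentIn (closure (D₁ ∪ D₂))ᶜ x := by
  obtain ⟨y, hy, hxy⟩ := mem_iUnion₂.1 hx
  rw [← connectedComponentIn_eq hxy]
  refine Subset.antisymm (iUnion₂_subset fun z hz => ?_) (subset_biUnion_of_mem hy)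
  have := hΩ.subset_connectedComponentIn hy (closure_compl_subset h₁ h₂) hz
  rw [connectedComponentIn_eq this]

theorem isPreconnected_exteriorComponent (h₁ : D₁ ⊆ Ω) (h₂ : D₂ ⊆ Ω)
    (hΩ : IsPreconnected (closure Ω)ᶜ) : IsPreconnected (exteriorComponent Ω D₁ D₂) := by
  rcases (exteriorComponent Ω D₁ D₂).eq_empty_or_nonempty with h | ⟨x, hx⟩
  · rw [h]; exact isPreconnected_empty
  · rw [exteriorComponent_eq h₁ h₂ hΩ hx]; exact isPreconnected_connectedComponentIn

theorem subset_exteriorComponent_of_isPreconnected (h₁ : D₁ ⊆ Ω) (h₂ : D₂ ⊆ Ω)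
    (hΩ : IsPreconnected (closure Ω)ᶜ) {S : Set Euc3} (hS : IsPreconnected S)
    (hSF : Disjoint S (closure (D₁ ∪ D₂))) {x : Euc3} (hxS : x ∈ S)
    (hx : x ∈ exteriorComponent Ω D₁ D₂) : S ⊆ exteriorComponent Ω D₁ D₂ := by
  rw [exteriorComponent_eq h₁ h₂ hΩ hx]
  exact hS.subset_connectedComponentIn hxS (subset_compl_iff_disjoint_right.2 hSF)

theorem disjoint_closure_exteriorComponent (hD₁ : IsOpen D₁) (hD₂ : IsOpen D₂) :
    Disjoint (closure (exteriorComponent Ω D₁ D₂)) (D₁ ∪ D₂) :=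
  (disjoint_left.2 fun _ hx hxD => exteriorComponent_subset hx (subset_closure hxD)).closure_left
    (hD₁.union hD₂)

theorem mem_frontier_filledUnion (hD₁ : IsOpen D₁) (hD₂ : IsOpen D₂) {x : Euc3}
    (hx : x ∈ closure (exteriorComponent Ω D₁ D₂)) (hxD : x ∈ closure (D₁ ∪ D₂)) :
    x ∈ frontier (filledUnion Ω D₁ D₂) := by
  rw [← frontier_compl, compl_filledUnion, isClosed_closure.frontier_eq]
  refine ⟨hx, fun hint => ?_⟩
  obtain ⟨y, hy, hyD⟩ := _root_.mem_closure_iff.1 hxD _ isOpen_interior hint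
  exact disjoint_left.1 (disjoint_closure_exteriorComponent hD₁ hD₂) (interior_subset hy) hyD

theorem frontier_filledUnion_subset : frontier (filledUnion Ω D₁ D₂) ⊆
    closure (exteriorComponent Ω D₁ D₂) := by
  rw [← frontier_compl, compl_filledUnion]
  exact isClosed_closure.frontier_subset

theorem mem_closure_of_mem_frontier_filledUnion (h₁ : D₁ ⊆ Ω) (h₂ : D₂ ⊆ Ω)
    (hΩ : IsPreconnected (closure Ω)ᶜ) {x : Euc3}
    (hx : x ∈ frontier (filledUnion Ω D₁ D₂)) : x ∈ closure (D₁ ∪ D₂) := by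
  by_contra hxF
  obtain ⟨r, hr, hball⟩ := Metric.isOpen_iff.1 isClosed_closure.isOpen_compl x hxF
  have hxG := frontier_filledUnion_subset hx
  obtain ⟨y, hy, hxy⟩ := Metric.mem_closure_iff.1 hxG r hr
  have hsub := subset_exteriorComponent_of_isPreconnected h₁ h₂ hΩ
    (convex_ball x r).isPreconnected (subset_compl_iff_disjoint_right.1 hball) (mem_ball'.2 hxy) hy
  rw [← frontier_compl, compl_filledUnion, isClosed_closure.frontier_eq] at hx
  exact hx.2 (mem_interior.2 ⟨_, hsub.trans subset_closure, isOpen_ball, mem_ball_self hr⟩)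

/-- If the intersection were empty, `hmod` would give `d_μ = 0`, the supremum of the empty set.
Every point of `∂Ω_D` would lie on `∂D₂` and off the closure of `D₁`, at positive distance from
`D₁`, although `d_μ` bounds that distance. -/
theorem nonempty_frontier_inter (hD₁ : IsOpen D₁) (hD₂ : IsOpen D₂) (hne : D₁.Nonempty)
    (h₁ : D₁ ⊆ Ω) (h₂ : D₂ ⊆ Ω) (hb : Bornology.IsBounded Ω) (hΩ : IsConnected (closure Ω)ᶜ)
    (hmod : modifiedDist Ω D₁ D₂ = sSup ((fun x => infDist x (frontier D₂)) ''
      (frontier D₁ ∩ frontier (filledUnion Ω D₁ D₂)))) :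
    (frontier D₁ ∩ frontier (filledUnion Ω D₁ D₂)).Nonempty := by
  by_contra! hempty
  obtain ⟨x, hx⟩ : (frontier (filledUnion Ω D₁ D₂)).Nonempty := by
    rw [nonempty_frontier_iff]
    constructor
    · obtain ⟨y, hy⟩ := hne
      exact ⟨y, fun h => disjoint_left.1 (disjoint_closure_exteriorComponent hD₁ hD₂) h (Or.inl hy)⟩
    · obtain ⟨y, hy⟩ := hΩ.nonempty
      exact fun h => (h ▸ mem_univ y : y ∈ filledUnion Ω D₁ D₂)
        (subset_closure (compl_subset_exteriorComponent h₁ h₂ hy))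
  have hxD := disjoint_left.1 (disjoint_closure_exteriorComponent hD₁ hD₂)
    (frontier_filledUnion_subset hx)
  have hxF := mem_closure_of_mem_frontier_filledUnion h₁ h₂ hΩ.isPreconnected hx
  have hx1 : x ∉ closure D₁ := fun h => hempty.subset
    ⟨hD₁.frontier_eq ▸ ⟨h, fun h' => hxD (Or.inl h')⟩, hx⟩
  rw [closure_union] at hxF
  have hx2 : x ∈ frontier D₂ :=
    hD₂.frontier_eq ▸ ⟨hxF.resolve_left hx1, fun h' => hxD (Or.inr h')⟩
  rw [hempty, image_empty, Real.sSup_empty] at hmod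
  have hcomp : IsCompact (frontier D₂ ∩ frontier (filledUnion Ω D₁ D₂)) :=
    (Metric.isCompact_of_isClosed_isBounded isClosed_frontier
      ((hb.subset h₂).closure.subset frontier_subset_closure)).inter_right isClosed_frontier
  have hle : infDist x D₁ ≤ 0 := by
    rw [← hmod]
    refine le_trans ?_ (le_max_right _ _)
    exact le_csSup (hcomp.image (continuous_infDist_pt D₁)).bddAbove ⟨x, ⟨hx2, hx⟩, rfl⟩
  exact hx1 ((mem_closure_iff_infDist_zero hne).2 (le_antisymm hle infDist_nonneg))

end Exterior

/-! ### Normals at a uniform scale. -/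

theorem IsPreconnected.thickening {V : Type*} [NormedAddCommGroup V] [NormedSpace ℝ V] {S : Set V}
    (hS : IsPreconnected S) (r : ℝ) : IsPreconnected (Metric.thickening r S) := by
  rw [← add_ball_zero, ← image2_add, ← image_uncurry_prod]
  exact (hS.prod (convex_ball (0 : V) r).isPreconnected).image _ continuous_add.continuousOn

/-- At each boundary point, `E` has a normal; it works for the slope `b` at the uniform scale `s`,
and for every slope at some scale. -/
def HasNormals (E : Set Euc3) (s b : ℝ) : Prop :=
  ∀ p ∈ frontier E, ∃ n : Euc3, ‖n‖ = 1 ∧ DownwardIn E p s b n ∧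
    ∀ b' > 0, ∃ t > 0, DownwardIn E p t b' n

theorem IsOfClassC1Holder.hasNormals {α ρ₀ M₀ σ b : ℝ} {E : Set Euc3}
    (h : IsOfClassC1Holder α ρ₀ M₀ E) (hα : 0 < α) (hρ : 0 < ρ₀) (hM : 0 < M₀)
    (hσ1 : σ ≤ 1) (hσb : M₀ * σ ^ α ≤ b) : HasNormals E (σ * ρ₀) b := by
  intro p hp
  obtain ⟨n, hn, hD⟩ := h.exists_normal hα hρ hM.le hp
  refine ⟨n, hn, hD _ _ (by nlinarith) (by rwa [mul_div_cancel_right₀ _ hρ.ne']), ?_⟩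
  intro b' hb'
  obtain ⟨τ, hτ, hτ1, hτb⟩ := exists_pos_mul_rpow_le hα hM hb'
  exact ⟨τ * ρ₀, by positivity,
    hD _ _ (by nlinarith) (by rwa [mul_div_cancel_right₀ _ hρ.ne'])⟩

theorem HasNormals.disjoint_or {E : Set Euc3} {s b : ℝ} (h : HasNormals E s b) {c z : Euc3}
    {r : ℝ} (hz : z ∈ ball c r) (hzE : z ∉ E) : Disjoint (ball c r) E ∨
      ∃ p ∈ frontier E, p ∈ ball c r ∧ ∃ n, ‖n‖ = 1 ∧ DownwardIn E p s b n := by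
  refine or_iff_not_imp_left.2 fun hd => ?_
  obtain ⟨y, hy, hyE⟩ := not_disjoint_iff.1 hd
  obtain ⟨p, hpb, hp⟩ := (convex_ball c r).isPreconnected.inter_frontier_nonempty
    ⟨y, hy, hyE⟩ ⟨z, hz, hzE⟩
  obtain ⟨n, hn, hD, -⟩ := h p hp
  exact ⟨p, hp, hpb, n, hn, hD⟩

theorem DownwardIn.of_frontier_point {V : Type*} [NormedAddCommGroup V] [InnerProductSpace ℝ V]
    {E : Set V} {p c n n' : V} {s a b d : ℝ}
    (h : DownwardIn E p s b n) (hp : p ∈ ball c (30 * d)) (hs : 60 * d ≤ s)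
    (hn : ‖n - n'‖ ≤ a - b) : DownwardIn E c (30 * d) a n' := by
  refine (h.mono (ball_subset_ball' ?_)).tilt hn
  rw [mem_ball, dist_comm] at hp
  linarith

theorem exists_norm_eq_one : ∃ n : Euc3, ‖n‖ = 1 := ⟨EuclideanSpace.single 0 1, by simp⟩

theorem infDist_le_dist_of_mem_closure {S : Set Euc3} {x p : Euc3} (hp : p ∈ closure S) :
    infDist x S ≤ dist x p := by
  rw [← infDist_closure]; exact infDist_le_dist_of_mem hp

/-! ### Connecting points of the shell outside `Ω`. -/

section Shell

variable {Ω : Set Euc3} {ρ₀ d a s : ℝ}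

theorem disjoint_ball_of_le_infDist {x : Euc3} {S : Set Euc3} (h : d ≤ infDist x S) :
    Disjoint (ball x d) S :=
  disjoint_left.2 fun y hy hyS => by
    have := infDist_le_dist_of_mem (x := x) hyS
    rw [mem_ball'] at hy
    linarith

/-- Points of the shell can be moved straight towards `Ω`. -/
theorem exists_joinedIn_of_mem_outerShell (hne : Ω.Nonempty) (hρ : 0 < ρ₀) (hd : 2 * d ≤ ρ₀)
    {x : Euc3} (hx : x ∈ outerShell Ω ρ₀) : ∃ y, infDist y Ω = ρ₀ / 2 ∧
      JoinedIn (clearCenters Ω {z | infDist z Ω < 2 * ρ₀} d) x y := by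
  obtain ⟨h1, h2⟩ := hx
  obtain ⟨q, hq, hqd⟩ := isClosed_closure.exists_infDist_eq_dist hne.closure x
  rw [infDist_closure] at h1 h2 hqd
  set D := infDist x Ω with hD
  have hD0 : 0 < D := hρ.trans h1
  have hval : ∀ t ∈ Icc (0 : ℝ) 1, infDist (x + t • (q - x)) Ω = (1 - t) * D := by
    intro t ht
    apply le_antisymm
    · refine (infDist_le_dist_of_mem_closure hq).trans (le_of_eq ?_)
      rw [dist_eq_norm, show x + t • (q - x) - q = (1 - t) • (x - q) by module, norm_smul,
        Real.norm_of_nonneg (by linarith [ht.2]), ← dist_eq_norm, hqd]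
    · have := infDist_le_infDist_add_dist (s := Ω) (x := x) (y := x + t • (q - x))
      rw [dist_comm, dist_eq_norm, add_sub_cancel_left, norm_smul, Real.norm_of_nonneg ht.1,
        ← dist_eq_norm, dist_comm, ← hqd, ← hD] at this
      linarith
  set τ := 1 - ρ₀ / (2 * D) with hτ
  have hτD : (1 - τ) * D = ρ₀ / 2 := by rw [hτ]; field_simp; ring
  have hτ0 : 0 ≤ τ := by
    rw [hτ, sub_nonneg, div_le_one (by positivity)]; linarith
  have hτ1 : τ ≤ 1 := by
    rw [hτ]; linarith [show 0 ≤ ρ₀ / (2 * D) by positivity]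
  refine ⟨x + τ • (q - x), by rw [hval τ ⟨hτ0, hτ1⟩, hτD], joinedIn_add_of_forall fun t ht => ?_⟩
  have htτ : t * τ ∈ Icc (0 : ℝ) 1 := ⟨mul_nonneg ht.1 hτ0, by nlinarith [ht.1, ht.2]⟩
  have htτ' : t * τ ≤ τ := mul_le_of_le_one_left hτ0 ht.2
  have hv := hval _ htτ
  rw [smul_smul]
  refine ⟨?_, disjoint_ball_of_le_infDist ?_⟩
  · rw [mem_ofPred_eq, hv]; nlinarith [htτ.1]
  · rw [hv]; nlinarith

/-- Both sets are open and connected and together they cover the space, so the result on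
intersections applies. -/
theorem isPreconnected_inter_thickening {G : Set Euc3} (hΩ : IsConnected Ω) (hρ : 0 < ρ₀)
    (hG : IsOpen G) (hGc : IsPreconnected G) (hΩG : (closure Ω)ᶜ ⊆ G) :
    IsPreconnected (G ∩ thickening ρ₀ Ω) := by
  refine isPreconnected_inter_of_union_eq_univ_of_normedSpace hG isOpen_thickening hGc
    (hΩ.isPreconnected.thickening ρ₀) (eq_univ_of_forall fun x => ?_)
  by_cases hx : x ∈ closure Ω
  · exact Or.inr (closure_subset_thickening hρ Ω hx)
  · exact Or.inl (hΩG hx)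

theorem ball_subset_of_mem_thickening (hne : Ω.Nonempty) (hd : 60 * d ≤ ρ₀) (hd0 : 0 < d)
    {x : Euc3} (hx : x ∈ thickening ρ₀ Ω) : ball x (30 * d) ⊆ {z | infDist z Ω < 2 * ρ₀} := by
  intro z hz
  rw [mem_thickening_iff_infDist_lt hne] at hx
  have := infDist_le_infDist_add_dist (s := Ω) (x := z) (y := x)
  rw [mem_ball] at hz
  rw [mem_ofPred_eq]
  linarith

/-- Both points are moved to distance `ρ₀ / 2` from `Ω`, then joined by continuation along the
outside of `Ω` with `F = Ω`. As `D₁` and `D₂` lie in `Ω`, one accessible shell point makes all of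
them accessible. -/
theorem joinedIn_of_mem_outerShell (hΩ : IsConnected Ω)
    (hΩc : IsConnected (closure Ω)ᶜ) (hρ : 0 < ρ₀) (hd0 : 0 < d) (ha₀ : 0 < a) (ha : a ≤ 1 / 2)
    (hs : 60 * d ≤ s) (hd : 60 * d ≤ ρ₀) (hN : HasNormals Ω s (a / 8))
    {x y : Euc3} (hx : x ∈ outerShell Ω ρ₀) (hy : y ∈ outerShell Ω ρ₀) :
    JoinedIn (clearCenters Ω {z | infDist z Ω < 2 * ρ₀} d) x y := by
  have hne := hΩ.nonempty
  obtain ⟨x', hx', hxx'⟩ := exists_joinedIn_of_mem_outerShell (d := d) hne hρ (by linarith) hx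
  obtain ⟨y', hy', hyy'⟩ := exists_joinedIn_of_mem_outerShell (d := d) hne hρ (by linarith) hy
  set H := (closure Ω)ᶜ ∩ thickening ρ₀ Ω with hH
  have hmemH : ∀ w, infDist w Ω = ρ₀ / 2 → w ∈ H := by
    intro w hw
    refine ⟨fun hwc => ?_, (mem_thickening_iff_infDist_lt hne).2 (by linarith)⟩
    rw [mem_closure_iff_infDist_zero hne] at hwc
    linarith
  have hHΩ : ∀ w ∈ H, w ∉ Ω := fun w hw hwΩ => hw.1 (subset_closure hwΩ)
  have hO : ∀ w ∈ H, ball w (30 * d) ⊆ {z | infDist z Ω < 2 * ρ₀} :=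
    fun w hw => ball_subset_of_mem_thickening hne hd hd0 hw.2
  have hloc : ∀ w ∈ H, ∃ n, ‖n‖ = 1 ∧ DownwardIn Ω w (30 * d) a n := by
    intro w hw
    rcases hN.disjoint_or (r := 30 * d) (mem_ball_self (by linarith)) (hHΩ w hw) with h | ⟨p, -, hp, n, hn, hD⟩
    · obtain ⟨n, hn⟩ := exists_norm_eq_one
      exact ⟨n, hn, .of_disjoint h⟩
    · exact ⟨n, hn, hD.of_frontier_point hp hs (by rw [sub_self, norm_zero]; linarith)⟩
  obtain ⟨z, hz, hzJ⟩ := (isPreconnected_inter_thickening hΩ hρ isClosed_closure.isOpen_compl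
    hΩc.isPreconnected Subset.rfl).exists_joinedIn_clearCenters hd0 ha₀.le ha hHΩ hO
    (fun w hw _ => hloc w hw) (hmemH x' hx') ⟨x', mem_ball_self (by linarith), hxx'⟩ y'
    (hmemH y' hy')
  obtain ⟨n, hn, hD⟩ := hloc y' (hmemH y' hy')
  have hzy := hD.joinedIn_clearCenters hd0 ha₀.le ha hn (hHΩ y' (hmemH y' hy'))
    (hO y' (hmemH y' hy')) (ball_subset_ball (by linarith) hz) (mem_ball_self (by linarith))
    hzJ.target_mem.2 hyy'.target_mem.2
  exact (hzJ.trans hzy).trans hyy'.symm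

end Shell

/-! ### Transverse normals give a touching ball; otherwise the normals are aligned. -/

section Inclusions

variable {Ω D₁ D₂ : Set Euc3} {ρ₀ d a s : ℝ}

theorem exists_touching_of_normal_sub (hD₁ : IsOpen D₁) (hne₂ : D₂.Nonempty) (h₁ : D₁ ⊆ Ω)
    (hd : 0 < d) (ha₀ : 0 < a) (ha : a ≤ 1 / 2) (hs : 1000 * d ≤ a * s) (hsρ : s ≤ ρ₀)
    (hN : HasNormals D₁ s (a / 8)) {c p₁ p₂ n₁ n₂ z : Euc3} (hp₁ : p₁ ∈ frontier D₁)
    (hp₁c : p₁ ∈ ball c (30 * d)) (hp₂c : p₂ ∈ ball c (30 * d)) (hzc : z ∈ ball c (30 * d))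
    (hz : z ∈ clearCenters (D₁ ∪ D₂) {z | infDist z Ω < 2 * ρ₀} d)
    (hn₁ : ‖n₁‖ = 1) (hn₂ : ‖n₂‖ = 1) (hD : DownwardIn D₁ p₁ s (a / 8) n₁)
    (hD' : DownwardIn D₂ p₂ s (a / 8) n₂) (hn : a / 2 ≤ ‖n₂ - n₁‖) :
    ∃ P ∈ frontier D₁, ∃ ν, IsOuterUnitNormal D₁ P ν ∧ a ^ 2 / 128 * d ≤ infDist P D₂ ∧
      JoinedIn (clearCenters (D₁ ∪ D₂) {z | infDist z Ω < 2 * ρ₀} d) z (P + d • ν) := by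
  have hz' := disjoint_union_right.1 hz.2
  obtain ⟨u, hu, hut, P, hP, hPd⟩ := exists_touching_ball hD₁ hd ha₀ ha hs
    (frontier_subset_closure hp₁) hp₁c hp₂c hzc hz'.1 hz'.2 hn₁ hn₂ hD hD' hn
  obtain ⟨ν, hν, hPD, hPt⟩ := hN P hP
  have hdist : ∀ p ∈ ball c (30 * d), ∀ t ∈ Icc (0 : ℝ) 1,
      a * dist (z + t • u) p ≤ 630 * d := by
    intro p hp t ht
    rw [mem_ball] at hp hzc
    have h3 := dist_triangle_right z p c
    have h4 := dist_triangle (z + t • u) z p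
    rw [dist_eq_norm (z + t • u) z, add_sub_cancel_left, norm_smul, Real.norm_of_nonneg ht.1] at h4
    have h5 : t * ‖u‖ ≤ ‖u‖ := mul_le_of_le_one_left (norm_nonneg u) ht.2
    have h6 : a * dist (z + t • u) p ≤ a * (‖u‖ + 60 * d) := by gcongr; linarith
    nlinarith
  have hPp : ∀ p ∈ ball c (30 * d), a * (dist P p + 3 * d) ≤ 632 * d := by
    intro p hp
    have h3 := hdist p hp 1 ⟨zero_le_one, le_rfl⟩
    rw [one_smul] at h3
    have h4 := dist_triangle_left P p (z + u)
    rw [hPd] at h4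
    nlinarith
  have hball : ∀ p ∈ ball c (30 * d), ball P (3 * d) ⊆ ball p s := by
    intro p hp
    refine ball_subset_ball' ?_
    have : a * (3 * d + dist P p) ≤ a * s := by linarith [hPp p hp]
    exact le_of_mul_le_mul_left this ha₀
  have hy : z + u = P + d • ν := by
    refine DownwardIn.eq_add_smul_of_disjoint_ball hd (frontier_subset_closure hP) hν hPt hPd ?_
    have := hut 1 ⟨zero_le_one, le_rfl⟩
    rw [one_smul] at this
    exact (disjoint_union_right.1 this).1
  have hs0 : 0 < s := pos_of_mul_pos_right (lt_of_lt_of_le (by positivity) hs) ha₀.le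
  have hνn₁ : ‖ν - n₁‖ ≤ 2 * (a / 8) :=
    hD.norm_normal_sub_le hD₁ hP (hball p₁ hp₁c (mem_ball_self (by positivity))) hs0 hPD hn₁ hν
      (by positivity)
  -- The normal at the touching point is within `a / 4` of `n₁`, so at least `a / 2 - a / 4` remains
  -- between `ν` and `n₂`. With `b = a / 4`, the bound `b ^ 2 / 8 * d` is `a ^ 2 / 128 * d`.
  have hνn₂ : a / 4 ≤ ‖ν - n₂‖ := by
    have := norm_sub_le_norm_sub_add_norm_sub n₂ ν n₁
    rw [norm_sub_rev n₂ ν] at this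
    linarith
  refine ⟨P, hP, ν, isOuterUnitNormal_of_downwardIn hD₁ hP hν hPt, ?_, ?_⟩
  · refine (le_infDist hne₂).2 fun {q} hq => ?_
    have := hD'.le_dist_of_disjoint_ball (m := ν) (p := P) (b := a / 4) hd hν hn₂ (by positivity)
      hνn₂ (by linarith) ?_ hq (hball p₂ hp₂c)
    · rw [dist_comm]
      convert this using 2
      ring
    · have := hut 1 ⟨zero_le_one, le_rfl⟩
      rw [one_smul, hy] at this
      exact (disjoint_union_right.1 this).2
  · rw [← hy]
    refine joinedIn_add_of_forall fun t ht => ⟨?_, hut t ht⟩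
    refine lt_of_le_of_lt (infDist_le_dist_of_mem_closure
      (closure_mono h₁ (frontier_subset_closure hp₁))) ?_
    have h7 : a * dist (z + t • u) p₁ ≤ a * s := by linarith [hdist p₁ hp₁c t ht]
    have h8 := le_of_mul_le_mul_left h7 ha₀
    linarith

/-- If no ball reachable from `z₀` touches `D₁` away from `D₂`, then near reachable points the
normals of `D₁` and `D₂` are aligned. -/
theorem downwardIn_union_of_not_exists_touching (hD₁ : IsOpen D₁) (hne₂ : D₂.Nonempty)
    (h₁ : D₁ ⊆ Ω) (hd : 0 < d) (ha₀ : 0 < a) (ha : a ≤ 1 / 2) (hs : 1000 * d ≤ a * s)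
    (hsρ : s ≤ ρ₀) (hN₁ : HasNormals D₁ s (a / 8)) (hN₂ : HasNormals D₂ s (a / 8))
    {z₀ : Euc3}
    (hno : ¬ ∃ P ∈ frontier D₁, ∃ ν, IsOuterUnitNormal D₁ P ν ∧ a ^ 2 / 128 * d ≤ infDist P D₂ ∧
      JoinedIn (clearCenters (D₁ ∪ D₂) {z | infDist z Ω < 2 * ρ₀} d) z₀ (P + d • ν))
    {c p n z : Euc3} (hp : p ∈ frontier D₁) (hpc : p ∈ ball c (30 * d)) (hn : ‖n‖ = 1)
    (hD : DownwardIn D₁ p s (a / 8) n) (hzc : z ∈ ball c (30 * d))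
    (hz : JoinedIn (clearCenters (D₁ ∪ D₂) {z | infDist z Ω < 2 * ρ₀} d) z₀ z) :
    DownwardIn (D₁ ∪ D₂) c (30 * d) a n := by
  have hs60 : 60 * d ≤ s := by
    have hs0 : 0 < s := pos_of_mul_pos_right (lt_of_lt_of_le (by positivity) hs) ha₀.le
    nlinarith
  refine (hD.of_frontier_point hpc hs60 (by rw [sub_self, norm_zero]; linarith)).union ?_
  have hz₂ : z ∉ D₂ := fun h =>
    disjoint_left.1 hz.target_mem.2 (mem_ball_self hd) (Or.inr h)
  rcases hN₂.disjoint_or hzc hz₂ with h | ⟨p₂, -, hp₂c, n₂, hn₂, hD'⟩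
  · exact .of_disjoint h
  · refine hD'.of_frontier_point hp₂c hs60 ?_
    -- Normals further apart than `a - a / 8` are in particular `a / 2` apart, which would produce
    -- the excluded touching ball.
    by_contra! hlt
    obtain ⟨P, hP, ν, hν, hPD, hJ⟩ := exists_touching_of_normal_sub hD₁ hne₂ h₁ hd ha₀ ha hs hsρ
      hN₁ hp hpc hp₂c hzc hz.target_mem hn hn₂ hD hD' (by linarith)
    exact hno ⟨P, hP, ν, hν, hPD, hz.trans hJ⟩

theorem exists_downwardIn_union_of_not_exists_touching (hD₁ : IsOpen D₁) (hne₂ : D₂.Nonempty)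
    (h₁ : D₁ ⊆ Ω) (hd : 0 < d) (ha₀ : 0 < a) (ha : a ≤ 1 / 2) (hs : 1000 * d ≤ a * s)
    (hsρ : s ≤ ρ₀) (hN₁ : HasNormals D₁ s (a / 8)) (hN₂ : HasNormals D₂ s (a / 8))
    {z₀ : Euc3}
    (hno : ¬ ∃ P ∈ frontier D₁, ∃ ν, IsOuterUnitNormal D₁ P ν ∧ a ^ 2 / 128 * d ≤ infDist P D₂ ∧
      JoinedIn (clearCenters (D₁ ∪ D₂) {z | infDist z Ω < 2 * ρ₀} d) z₀ (P + d • ν))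
    {c z : Euc3} (hzc : z ∈ ball c (30 * d))
    (hz : JoinedIn (clearCenters (D₁ ∪ D₂) {z | infDist z Ω < 2 * ρ₀} d) z₀ z) :
    ∃ n, ‖n‖ = 1 ∧ DownwardIn (D₁ ∪ D₂) c (30 * d) a n := by
  have hs60 : 60 * d ≤ s := by
    have hs0 : 0 < s := pos_of_mul_pos_right (lt_of_lt_of_le (by positivity) hs) ha₀.le
    nlinarith
  have hzD : z ∉ D₁ ∪ D₂ := fun h => disjoint_left.1 hz.target_mem.2 (mem_ball_self hd) h
  rcases hN₁.disjoint_or hzc fun h => hzD (Or.inl h) with h | ⟨p, hp, hpc, n, hn, hD⟩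
  · rcases hN₂.disjoint_or hzc fun h => hzD (Or.inr h) with h' | ⟨p₂, -, hp₂c, n₂, hn₂, hD'⟩
    · obtain ⟨n, hn⟩ := exists_norm_eq_one
      exact ⟨n, hn, .of_disjoint (disjoint_union_right.2 ⟨h, h'⟩)⟩
    · exact ⟨n₂, hn₂, DownwardIn.union (.of_disjoint h)
        (hD'.of_frontier_point hp₂c hs60 (by rw [sub_self, norm_zero]; linarith))⟩
  · exact ⟨n, hn, downwardIn_union_of_not_exists_touching hD₁ hne₂ h₁ hd ha₀ ha hs hsρ hN₁ hN₂ hno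
      hp hpc hn hD hzc hz⟩

end Inclusions

/-! ### Balls inscribed in cones and cones inscribed in balls. -/

theorem inner_ge_of_norm_sub_smul_le {V : Type*} [NormedAddCommGroup V] [InnerProductSpace ℝ V]
    {w ν : V} {a k t : ℝ} (hν : ‖ν‖ = 1) (ht : 0 < t) (hak : a ^ 2 + k ^ 2 = 1)
    (h : ‖w - t • ν‖ ≤ k * t) : a * ‖w‖ ≤ inner ℝ w ν := by
  have h1 : ‖w - t • ν‖ ^ 2 ≤ (k * t) ^ 2 := by gcongr
  rw [norm_sub_sq_real, norm_smul, hν, real_inner_smul_right, Real.norm_of_nonneg ht.le] at h1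
  have h2 : t * (a * ‖w‖) ≤ t * inner ℝ w ν := by
    have : k ^ 2 * t ^ 2 = (1 - a ^ 2) * t ^ 2 := by rw [← hak]; ring
    nlinarith [sq_nonneg (‖w‖ - a * t)]
  exact le_of_mul_le_mul_left h2 ht

theorem inner_ge_of_mem_truncatedCone {P ν x : Euc3} {a k h : ℝ} (hν : ‖ν‖ = 1)
    (hk : 0 ≤ k) (hak : a ^ 2 + k ^ 2 = 1) (hx : x ∈ truncatedCone P ν h (Real.arcsin k)) :
    a * ‖x - P‖ ≤ inner ℝ (x - P) ν ∧ inner ℝ (x - P) ν ≤ h := by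
  obtain ⟨h1, h2, h3⟩ := hx
  refine ⟨?_, h3⟩
  rw [Real.sin_arcsin (by linarith) (by nlinarith)] at h1
  have h4 : ‖(x - P) - (inner ℝ (x - P) ν : ℝ) • ν‖ ^ 2 ≤ (k * ‖x - P‖) ^ 2 := by gcongr
  rw [norm_sub_sq_real, norm_smul, hν, real_inner_smul_right, Real.norm_of_nonneg h2] at h4
  refine abs_le_of_sq_le_sq' ?_ h2 |>.2
  have : k ^ 2 * ‖x - P‖ ^ 2 = (1 - a ^ 2) * ‖x - P‖ ^ 2 := by rw [← hak]; ring
  nlinarith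

/-- For `w = x - P` the height bound gives `‖w‖ ≤ d * a`, hence `‖w‖ ^ 2 ≤ d * ⟪w, ν⟫`, more than
enough to lie in the ball tangent at `P`. -/
theorem truncatedCone_subset_closedBall {P ν : Euc3} {a k d : ℝ} (hν : ‖ν‖ = 1) (ha : 0 < a)
    (hk : 0 ≤ k) (hak : a ^ 2 + k ^ 2 = 1) (hd : 0 ≤ d) :
    truncatedCone P ν (d * a ^ 2) (Real.arcsin k) ⊆ closedBall (P + d • ν) d := by
  intro x hx
  obtain ⟨h1, h2⟩ := inner_ge_of_mem_truncatedCone hν hk hak hx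
  have h3 : ‖x - P‖ ≤ d * a := by
    have : a * ‖x - P‖ ≤ a * (d * a) := by linarith
    exact le_of_mul_le_mul_left this ha
  rw [mem_closedBall_iff_norm, ← sub_sub]
  refine le_of_sq_le_sq ?_ hd
  rw [norm_sub_sq_real, norm_smul, hν, real_inner_smul_right, Real.norm_of_nonneg hd]
  nlinarith [norm_nonneg (x - P)]

theorem infDist_frontier_le {V : Type*} [NormedAddCommGroup V] [NormedSpace ℝ V] {S : Set V}
    {x : V} (hS : S.Nonempty) (hx : x ∉ S) : infDist x (frontier S) ≤ infDist x S := by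
  refine (le_infDist hS).2 fun {q} hq => ?_
  obtain ⟨p, hpb, hp⟩ := (convex_closedBall x (dist x q)).isPreconnected.inter_frontier_nonempty
    ⟨q, mem_closedBall'.2 le_rfl, hq⟩ ⟨x, mem_closedBall_self dist_nonneg, hx⟩
  exact (infDist_le_dist_of_mem hp).trans (mem_closedBall'.1 hpb)

/-! ### The dichotomy and the accessible point. -/

section Conclusion

variable {Ω D₁ D₂ : Set Euc3} {ρ₀ d a s : ℝ}

theorem JoinedIn.ball_subset_exteriorComponent (h₁ : D₁ ⊆ Ω) (h₂ : D₂ ⊆ Ω)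
    (hΩ : IsPreconnected (closure Ω)ᶜ) (hd : 0 < d) {O : Set Euc3} {x y : Euc3}
    (h : JoinedIn (clearCenters (D₁ ∪ D₂) O d) x y) (hx : x ∈ exteriorComponent Ω D₁ D₂) :
    JoinedIn {z | z ∈ O ∧ ball z d ⊆ exteriorComponent Ω D₁ D₂} x y := by
  obtain ⟨γ, hγ⟩ := h
  have hdis : ∀ t, Disjoint (ball (γ t) d) (closure (D₁ ∪ D₂)) := fun t =>
    (hγ t).2.closure_right isOpen_ball
  have hsub : range γ ⊆ exteriorComponent Ω D₁ D₂ := by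
    refine subset_exteriorComponent_of_isPreconnected h₁ h₂ hΩ (isPreconnected_range γ.continuous)
      (disjoint_left.2 ?_) ⟨0, γ.source⟩ hx
    rintro _ ⟨t, rfl⟩
    exact disjoint_left.1 (hdis t) (mem_ball_self hd)
  exact ⟨γ, fun t => ⟨(hγ t).1, subset_exteriorComponent_of_isPreconnected h₁ h₂ hΩ
    (convex_ball _ _).isPreconnected (hdis t) (mem_ball_self hd) (hsub ⟨t, rfl⟩)⟩⟩

/-- A point `x` of `𝒢` near `P` is translated by `y - P`. The segment it sweeps misses the closure
of `D₁ ∪ D₂`, since otherwise the cone condition would pull `x` into that closure. So the segment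
stays in `𝒢` and ends near `y`. -/
theorem mem_closure_exteriorComponent_of_downwardIn (h₁ : D₁ ⊆ Ω) (h₂ : D₂ ⊆ Ω)
    (hΩ : IsPreconnected (closure Ω)ᶜ) {P n y : Euc3} {r : ℝ}
    (h : DownwardIn (D₁ ∪ D₂) P r a n) (hP : P ∈ closure (exteriorComponent Ω D₁ D₂))
    (hy : y ∈ ball P r) (hyP : a * ‖y - P‖ ≤ inner ℝ (y - P) n) :
    y ∈ closure (exteriorComponent Ω D₁ D₂) := by
  rw [Metric.mem_closure_iff]
  intro ε hε
  have hyr : dist y P < r := hy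
  obtain ⟨x, hx, hxP⟩ := Metric.mem_closure_iff.1 hP (min ε (r - dist y P))
    (lt_min hε (by linarith))
  obtain ⟨hxε, hxr⟩ := lt_min_iff.1 hxP
  rw [dist_comm] at hxr hxε
  have hxb : x ∈ ball P r := mem_ball.2 (by linarith [dist_nonneg (x := y) (y := P)])
  have hyb : x + (y - P) ∈ ball P r := by
    rw [mem_ball_iff_norm, show x + (y - P) - P = (x - P) + (y - P) by abel]
    rw [dist_eq_norm] at hxr hyr
    rw [dist_eq_norm] at hxr
    exact (norm_add_le _ _).trans_lt (by linarith)
  have hseg : Disjoint (segment ℝ x (x + (y - P))) (closure (D₁ ∪ D₂)) := by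
    rw [disjoint_left]
    intro w hw hwF
    have hwb := (convex_ball P r).segment_subset hxb hyb hw
    rw [segment_eq_image'] at hw
    obtain ⟨t, ht, rfl⟩ := hw
    refine exteriorComponent_subset hx (h.closure _ hwF hwb x hxb ?_)
    simp only [add_sub_cancel_left]
    rw [norm_smul, real_inner_smul_left, Real.norm_of_nonneg ht.1]
    nlinarith [mul_le_mul_of_nonneg_left hyP ht.1]
  refine ⟨x + (y - P), subset_exteriorComponent_of_isPreconnected h₁ h₂ hΩ
    (convex_segment _ _).isPreconnected hseg (left_mem_segment ℝ _ _) hx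
    (right_mem_segment ℝ _ _), ?_⟩
  rw [dist_eq_norm, show y - (x + (y - P)) = P - x by abel, ← dist_eq_norm, dist_comm]
  exact hxε

theorem outerShell_subset_exteriorComponent (h₁ : D₁ ⊆ Ω) (h₂ : D₂ ⊆ Ω) (hρ : 0 < ρ₀) :
    outerShell Ω ρ₀ ⊆ exteriorComponent Ω D₁ D₂ := by
  refine fun x hx => compl_subset_exteriorComponent h₁ h₂ fun hxc => ?_
  have := hx.1
  rw [infDist_zero_of_mem hxc] at this
  linarith

/-- The path required in the theorem, from a path of centres of balls in the exterior. -/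
theorem exists_path_of_joinedIn (hne : Ω.Nonempty) (hρ : 0 < ρ₀) {R h θ : ℝ} (hR : 0 < R)
    {P ν P₀ : Euc3}
    (hJ : JoinedIn {z | infDist z Ω < 2 * ρ₀ ∧ ball z R ⊆ closure (exteriorComponent Ω D₁ D₂)}
      P₀ (P + d • ν))
    (hcone : truncatedCone P ν h θ ⊆ closure (exteriorComponent Ω D₁ D₂))
    (hh : h = (d ^ 2 - R ^ 2) / d) (hθ : θ = Real.arcsin (R / d)) :
    ∃ γ : Path P₀ (P + d • ν),
      range γ ⊆ (closure (thickening ρ₀ Ω) ∪ outerShell Ω ρ₀) \ closure (filledUnion Ω D₁ D₂) ∧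
      tubeWithCone P ν d R (range γ) ⊆ (filledUnion Ω D₁ D₂)ᶜ := by
  obtain ⟨γ, hγ⟩ := hJ
  refine ⟨γ, ?_, ?_⟩
  · rintro _ ⟨t, rfl⟩
    obtain ⟨h1, h2⟩ := hγ t
    refine ⟨?_, fun hc => ?_⟩
    · rcases lt_or_ge ρ₀ (infDist (γ t) Ω) with h3 | h3
      · exact Or.inr ⟨by rwa [infDist_closure], by rwa [infDist_closure]⟩
      · left
        rw [closure_thickening hρ]
        obtain ⟨q, hq, hqd⟩ := isClosed_closure.exists_infDist_eq_dist hne.closure (γ t)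
        rw [infDist_closure] at hqd
        rw [← cthickening_closure]
        exact mem_cthickening_of_dist_le _ q _ _ hq (hqd ▸ h3)
    · obtain ⟨y, hy, hyF⟩ := _root_.mem_closure_iff.1 hc _ isOpen_ball (mem_ball_self hR)
      exact hyF (h2 hy)
  · rw [compl_filledUnion]
    refine union_subset (iUnion₂_subset ?_) (by rwa [← hh, ← hθ])
    rintro _ ⟨t, rfl⟩
    exact (hγ t).2

/-- The geometric core, with constants given in terms of the scale `s` of flatness. -/
theorem exists_accessible_point {k L c₁ : ℝ} (hρ : 0 < ρ₀)
    (hΩ : IsConnected Ω) (hb : Bornology.IsBounded Ω)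
    (hΩc : IsConnected (closure Ω)ᶜ)
    (hD₁ : IsOpen D₁) (hne₁ : D₁.Nonempty) (h₁ : D₁ ⊆ Ω)
    (hD₂ : IsOpen D₂) (hne₂ : D₂.Nonempty) (h₂ : D₂ ⊆ Ω)
    (hd : 0 < d) (ha₀ : 0 < a) (ha : a ≤ 1 / 2) (hs : 1000 * d ≤ a * s) (hsρ : s ≤ ρ₀)
    (hk : 0 < k) (hak : a ^ 2 + k ^ 2 = 1)
    (hNΩ : HasNormals Ω s (a / 8)) (hN₁ : HasNormals D₁ s (a / 8))
    (hN₂ : HasNormals D₂ s (a / 8))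
    (hdiam : ∀ x ∈ closure Ω, ∀ y ∈ closure Ω, dist x y ≤ L)
    (hc₁ : 0 ≤ c₁) (hc₁' : c₁ ≤ 1) (hc₁L : c₁ * L ≤ a ^ 2 / 128 * d)
    (hmod : modifiedDist Ω D₁ D₂ = sSup ((fun x => infDist x (frontier D₂)) ''
      (frontier D₁ ∩ frontier (filledUnion Ω D₁ D₂)))) :
    ∃ P ν : Euc3, P ∈ frontier D₁ ∩ frontier (filledUnion Ω D₁ D₂) ∧ IsOuterUnitNormal D₁ P ν ∧
      c₁ * modifiedDist Ω D₁ D₂ ≤ infDist P D₂ ∧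
      ∀ P₀ ∈ outerShell Ω ρ₀, ∃ γ : Path P₀ (P + d • ν),
        range γ ⊆ (closure (thickening ρ₀ Ω) ∪ outerShell Ω ρ₀) \ closure (filledUnion Ω D₁ D₂) ∧
        tubeWithCone P ν d (d * k) (range γ) ⊆ (filledUnion Ω D₁ D₂)ᶜ := by
  have hΩp := hΩc.isPreconnected
  have hs0 : 0 < s := pos_of_mul_pos_right (lt_of_lt_of_le (by positivity) hs) ha₀.le
  have hs60 : 60 * d ≤ s := by nlinarith
  have hk1 : k ≤ 1 := by nlinarith
  have hheight : (d ^ 2 - (d * k) ^ 2) / d = d * a ^ 2 := by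
    rw [show a ^ 2 = 1 - k ^ 2 by linarith]; field_simp
  have hangle : d * k / d = k := by field_simp
  obtain ⟨Q, ⟨hQ₁, hQF⟩, hQmax⟩ : ∃ Q ∈ frontier D₁ ∩ frontier (filledUnion Ω D₁ D₂),
      sSup ((fun x => infDist x (frontier D₂)) ''
        (frontier D₁ ∩ frontier (filledUnion Ω D₁ D₂))) = infDist Q (frontier D₂) := by
    refine IsCompact.exists_sSup_image_eq ?_
      (nonempty_frontier_inter hD₁ hD₂ hne₁ h₁ h₂ hb hΩc hmod)
      (continuous_infDist_pt _).continuousOn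
    exact (Metric.isCompact_of_isClosed_isBounded isClosed_frontier
      ((hb.subset h₁).closure.subset frontier_subset_closure)).inter_right isClosed_frontier
  rw [hmod, hQmax]
  have hQG := frontier_filledUnion_subset hQF
  have hQD : Q ∉ D₁ ∪ D₂ := disjoint_left.1 (disjoint_closure_exteriorComponent hD₁ hD₂) hQG
  have hQΩ : Q ∈ closure Ω := closure_mono h₁ (frontier_subset_closure hQ₁)
  -- The dichotomy: if a reachable ball touches `D₁` at distance `a ^ 2 / 128 * d` from `D₂`, the
  -- touching point is used. Otherwise the maximizer `Q` is used.
  by_cases htouch : ∃ P₀ ∈ outerShell Ω ρ₀, ∃ P ∈ frontier D₁, ∃ ν, IsOuterUnitNormal D₁ P ν ∧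
      a ^ 2 / 128 * d ≤ infDist P D₂ ∧
      JoinedIn (clearCenters (D₁ ∪ D₂) {z | infDist z Ω < 2 * ρ₀} d) P₀ (P + d • ν)
  · obtain ⟨P₁, hP₁, P, hP, ν, hν, hPD, hJ⟩ := htouch
    have hball : ball (P + d • ν) d ⊆ exteriorComponent Ω D₁ D₂ :=
      (hJ.ball_subset_exteriorComponent h₁ h₂ hΩp hd
        (outerShell_subset_exteriorComponent h₁ h₂ hρ hP₁)).target_mem.2
    have hcball : closedBall (P + d • ν) d ⊆ closure (exteriorComponent Ω D₁ D₂) := by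
      rw [← closure_ball _ hd.ne']; exact closure_mono hball
    have hPG : P ∈ closure (exteriorComponent Ω D₁ D₂) := by
      refine hcball ?_
      rw [mem_closedBall_iff_norm, sub_add_cancel_left, norm_neg, norm_smul, hν.2.1,
        Real.norm_of_nonneg hd.le, mul_one]
    refine ⟨P, ν, ⟨hP, mem_frontier_filledUnion hD₁ hD₂ hPG
      (closure_mono subset_union_left (frontier_subset_closure hP))⟩, hν, ?_, fun P₀ hP₀ => ?_⟩
    · refine le_trans ?_ (hc₁L.trans hPD)
      gcongr
      have hL : 0 ≤ L := dist_nonneg.trans (hdiam Q hQΩ Q hQΩ)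
      rcases (frontier D₂).eq_empty_or_nonempty with h | ⟨q, hq⟩
      · rw [h, infDist_empty]; exact hL
      · exact (infDist_le_dist_of_mem hq).trans
          (hdiam Q hQΩ q (closure_mono h₂ (frontier_subset_closure hq)))
    · have hJ₀ := joinedIn_of_mem_outerShell (s := s) hΩ hΩc hρ hd ha₀ ha hs60
        (by linarith) hNΩ hP₀ hP₁
      have hJ₁ := (hJ₀.mono fun z hz =>
        ⟨hz.1, hz.2.mono_right (union_subset h₁ h₂)⟩ : JoinedIn
          (clearCenters (D₁ ∪ D₂) {z | infDist z Ω < 2 * ρ₀} d) P₀ P₁).trans hJ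
      refine exists_path_of_joinedIn hΩ.nonempty hρ (by positivity)
        ((hJ₁.ball_subset_exteriorComponent h₁ h₂ hΩp hd
          (outerShell_subset_exteriorComponent h₁ h₂ hρ hP₀)).mono fun z hz => ⟨hz.1,
            (ball_subset_ball (by nlinarith)).trans (hz.2.trans subset_closure)⟩) ?_
        hheight.symm rfl
      rw [hangle]
      exact (truncatedCone_subset_closedBall hν.2.1 ha₀ hk.le hak hd.le).trans hcball
  · obtain ⟨ν, hν, hDν, hνt⟩ := hN₁ Q hQ₁
    refine ⟨Q, ν, ⟨hQ₁, hQF⟩, isOuterUnitNormal_of_downwardIn hD₁ hQ₁ hν hνt, ?_,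
      fun P₀ hP₀ => ?_⟩
    -- The maximum is measured to `∂D₂`. As `Q ∉ D₂`, the distance to `D₂` is no smaller.
    · refine (mul_le_of_le_one_left infDist_nonneg hc₁').trans ?_
      exact infDist_frontier_le hne₂ fun h => hQD (Or.inr h)
    · have hno : ¬ ∃ P ∈ frontier D₁, ∃ ν, IsOuterUnitNormal D₁ P ν ∧
          a ^ 2 / 128 * d ≤ infDist P D₂ ∧
          JoinedIn (clearCenters (D₁ ∪ D₂) {z | infDist z Ω < 2 * ρ₀} d) P₀ (P + d • ν) :=
        fun h => htouch ⟨P₀, hP₀, h⟩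
      have hP₀G := outerShell_subset_exteriorComponent h₁ h₂ hρ hP₀
      obtain ⟨x₀, hx₀, hJ₀⟩ := exists_joinedIn_of_mem_outerShell (d := d) hΩ.nonempty hρ
        (by linarith) hP₀
      have hJ₁ : JoinedIn (clearCenters (D₁ ∪ D₂) {z | infDist z Ω < 2 * ρ₀} d) P₀ x₀ :=
        hJ₀.mono fun z hz => ⟨hz.1, hz.2.mono_right (union_subset h₁ h₂)⟩
      have hx₀H : x₀ ∈ exteriorComponent Ω D₁ D₂ ∩ thickening ρ₀ Ω :=
        ⟨(hJ₁.ball_subset_exteriorComponent h₁ h₂ hΩp hd hP₀G).target_mem.2 (mem_ball_self hd),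
          (mem_thickening_iff_infDist_lt hΩ.nonempty).2 (by linarith)⟩
      have hreach := (isPreconnected_inter_thickening hΩ hρ isOpen_exteriorComponent
        (isPreconnected_exteriorComponent h₁ h₂ hΩp)
        (compl_subset_exteriorComponent h₁ h₂)).exists_joinedIn_clearCenters
        (F := D₁ ∪ D₂) (O := {z | infDist z Ω < 2 * ρ₀}) (z₀ := P₀) hd ha₀.le ha
        (fun x hx hxD => exteriorComponent_subset hx.1 (subset_closure hxD))
        (fun x hx => ball_subset_of_mem_thickening hΩ.nonempty (by linarith) hd hx.2)
        (fun x hx ⟨z, hz, hzJ⟩ => exists_downwardIn_union_of_not_exists_touching hD₁ hne₂ h₁ hd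
          ha₀ ha hs hsρ hN₁ hN₂ hno (ball_subset_ball (by linarith) hz) hzJ)
        hx₀H ⟨x₀, mem_ball_self (by linarith), hJ₁⟩
      obtain ⟨x, hx, hQx⟩ := Metric.mem_closure_iff.1 hQG d hd
      have hQth : ∀ y, dist Q y < ρ₀ → y ∈ thickening ρ₀ Ω := fun y hy =>
        (mem_thickening_iff_infDist_lt hΩ.nonempty).2
          ((infDist_le_dist_of_mem_closure hQΩ).trans_lt (by rwa [dist_comm]))
      obtain ⟨z, hz, hzJ⟩ := hreach x ⟨hx, hQth x (by linarith)⟩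
      have hzQ : z ∈ ball Q (5 * d) := by
        rw [mem_ball] at *
        have := dist_triangle z x Q
        rw [dist_comm x Q] at this
        linarith
      have hDQ := downwardIn_union_of_not_exists_touching hD₁ hne₂ h₁ hd ha₀ ha hs hsρ hN₁ hN₂ hno
        hQ₁ (mem_ball_self (by linarith)) hν hDν (ball_subset_ball (by linarith) hzQ) hzJ
      have hO := ball_subset_of_mem_thickening hΩ.nonempty (by linarith : 60 * d ≤ ρ₀) hd
        (hQth Q (by rw [dist_self]; exact hρ))
      have hup : Q + (4 * d) • ν ∈ ball Q (5 * d) := by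
        rw [mem_ball_iff_norm, add_sub_cancel_left, norm_smul, hν,
          Real.norm_of_nonneg (by positivity)]
        linarith
      have hJ₂ := hzJ.trans (hDQ.joinedIn_clearCenters hd ha₀.le ha hν hQD hO hzQ hup
        hzJ.target_mem.2 (hDQ.disjoint_ball_add_smul hd ha₀.le ha hν hQD (by linarith)
          (by linarith)))
      have hconeG : ∀ y ∈ ball Q (30 * d), a * ‖y - Q‖ ≤ inner ℝ (y - Q) ν →
          y ∈ closure (exteriorComponent Ω D₁ D₂) := fun y hy hyQ =>
        mem_closure_exteriorComponent_of_downwardIn h₁ h₂ hΩp hDQ hQG hy hyQ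
      -- Full balls of radius `d` reach only height `4 * d` above `Q`. The remaining descent to
      -- height `d` uses radius `d * k`: a ball of radius `k * t` centred at height `t` lies in the
      -- cone of slope `a` above `Q`, as `a ^ 2 + k ^ 2 = 1`.
      have hJ₃ : JoinedIn {z | infDist z Ω < 2 * ρ₀ ∧
          ball z (d * k) ⊆ closure (exteriorComponent Ω D₁ D₂)} (Q + d • ν) (Q + (4 * d) • ν) := by
        rw [show Q + (4 * d) • ν = (Q + d • ν) + (3 * d) • ν by module]
        refine joinedIn_add_of_forall fun t ht => ?_
        rw [show Q + d • ν + t • (3 * d) • ν = Q + (d + 3 * d * t) • ν by module]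
        have htd : 0 ≤ d * t := mul_nonneg hd.le ht.1
        have htd' : d * t ≤ d := mul_le_of_le_one_right hd.le ht.2
        have hτ : d ≤ d + 3 * d * t := by linarith
        have hτ4 : d + 3 * d * t ≤ 4 * d := by linarith
        have hdist : dist (Q + (d + 3 * d * t) • ν) Q ≤ 4 * d := by
          rw [dist_eq_norm, add_sub_cancel_left, norm_smul, hν,
            Real.norm_of_nonneg (by linarith), mul_one]
          exact hτ4
        refine ⟨hO (mem_ball.2 (by linarith)), fun y hy => hconeG y ?_ ?_⟩
        · refine ball_subset_ball' ?_ hy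
          nlinarith
        · refine inner_ge_of_norm_sub_smul_le hν (hd.trans_le hτ) hak ?_
          rw [mem_ball_iff_norm, ← sub_sub] at hy
          nlinarith
      have hsubset : {z | z ∈ {z | infDist z Ω < 2 * ρ₀} ∧ ball z d ⊆ exteriorComponent Ω D₁ D₂} ⊆
          {z | infDist z Ω < 2 * ρ₀ ∧
            ball z (d * k) ⊆ closure (exteriorComponent Ω D₁ D₂)} := fun z hz => ⟨hz.1,
        (ball_subset_ball (by nlinarith)).trans (hz.2.trans subset_closure)⟩
      refine exists_path_of_joinedIn hΩ.nonempty hρ (by positivity)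
        (((hJ₂.ball_subset_exteriorComponent h₁ h₂ hΩp hd hP₀G).mono hsubset).trans hJ₃.symm) ?_
        hheight.symm rfl
      rw [hangle]
      intro y hy
      refine hconeG y ?_ (inner_ge_of_mem_truncatedCone hν hk.le hak hy).1
      have h3 := truncatedCone_subset_closedBall hν ha₀ hk.le hak hd.le hy
      have h4 := dist_triangle y (Q + d • ν) Q
      rw [dist_eq_norm (Q + d • ν) Q, add_sub_cancel_left, norm_smul, hν,
        Real.norm_of_nonneg hd.le] at h4
      rw [mem_closedBall] at h3
      rw [mem_ball]
      linarith

end Conclusion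

/-! ### Choice of constants. -/

theorem mainTheorem7 (M₀ α : ℝ) (hM₀ : 0 < M₀) (hα₀ : 0 < α) (hα₁ : α < 1) :
    -- `δ = d̄ / ρ₀` and `L₀` depend only on `M₀`, `α`
    ∃ δ L₀ : ℝ, 0 < δ ∧ 0 < L₀ ∧ L₀ ≤ M₀ ∧
      ∀ M₁ : ℝ, 0 < M₁ →
        -- `c₁` depends only on `M₀`, `α`, `M₁`
        ∃ c₁ : ℝ, 0 < c₁ ∧
          ∀ (ρ₀ : ℝ) (Ω D₁ D₂ : Set Euc3), 0 < ρ₀ →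
            IsDomain3 Ω → Bornology.IsBounded Ω → IsConnected (closure Ω)ᶜ →
            volume Ω ≤ ENNReal.ofReal (M₁ * ρ₀ ^ 3) → IsOfClassC1Holder α ρ₀ M₀ Ω →
            IsDomain3 D₁ → D₁ ⊆ Ω → IsConnected (closure D₁)ᶜ → IsOfClassC1Holder α ρ₀ M₀ D₁ →
            IsDomain3 D₂ → D₂ ⊆ Ω → IsConnected (closure D₂)ᶜ → IsOfClassC1Holder α ρ₀ M₀ D₂ →
            modifiedDist Ω D₁ D₂ =
              sSup ((fun x => infDist x (frontier D₂)) ''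
                (frontier D₁ ∩ frontier (filledUnion Ω D₁ D₂))) →
            ∃ P ν : Euc3,
              P ∈ frontier D₁ ∩ frontier (filledUnion Ω D₁ D₂) ∧
              IsOuterUnitNormal D₁ P ν ∧
              c₁ * modifiedDist Ω D₁ D₂ ≤ infDist P D₂ ∧
              ∀ P₀ ∈ outerShell Ω ρ₀,
                ∃ γ : Path P₀ (P + (δ * ρ₀) • ν),
                  range γ ⊆ (closure (thickening ρ₀ Ω) ∪ outerShell Ω ρ₀) \
                    closure (filledUnion Ω D₁ D₂) ∧
                  tubeWithCone P ν (δ * ρ₀) (δ * ρ₀ / √(1 + L₀ ^ 2)) (range γ) ⊆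
                    (filledUnion Ω D₁ D₂)ᶜ := by
  -- The cap `1 / 2` ensures `a ≤ 1 / 2`. Here `a = L₀ / √(1 + L₀ ^ 2)` and `1 / q` are the sine and
  -- cosine of the angle whose tangent is `L₀`.
  set L₀ := min M₀ (1 / 2) with hL₀
  have hL₀0 : 0 < L₀ := lt_min hM₀ (by norm_num)
  set q := √(1 + L₀ ^ 2) with hq
  have hq2 : q ^ 2 = 1 + L₀ ^ 2 := Real.sq_sqrt (by positivity)
  have hq1 : 1 ≤ q := Real.one_le_sqrt.2 (by nlinarith)
  set a := L₀ / q with ha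
  have ha0 : 0 < a := by positivity
  have ha2 : a ≤ 1 / 2 := (div_le_self hL₀0.le hq1).trans (min_le_right _ _)
  have hak : a ^ 2 + (1 / q) ^ 2 = 1 := by
    rw [ha, div_pow, div_pow, ← add_div, div_eq_one_iff_eq (by positivity), hq2]; ring
  obtain ⟨σ, hσ, hσ1, hσa⟩ := exists_pos_mul_rpow_le hα₀ hM₀ (show 0 < a / 8 by positivity)
  refine ⟨a * σ / 1000, L₀, by positivity, hL₀0, min_le_left _ _, fun M₁ hM₁ => ?_⟩
  set v := (volume (ball (0 : Euc3) 1)).toReal with hv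
  have hv0 : 0 < v := ENNReal.toReal_pos (measure_ball_pos volume _ one_pos).ne'
    measure_ball_lt_top.ne
  set K := 3 * σ * (M₁ / ((σ / 8) ^ 3 * v) + 1) with hK
  have hK0 : 0 < K := by positivity
  -- The diameter of `Ω` is at most `K * ρ₀`, so the second term makes `c₁ * K * ρ₀` at most `a ^ 2
  -- / 128 * d`, as the touching case needs. The bound by 1 serves the maximizer case.
  refine ⟨min 1 (a ^ 2 / 128 * (a * σ / 1000) / K), by positivity, ?_⟩
  intro ρ₀ Ω D₁ D₂ hρ hΩ hΩb hΩc hvol hΩC hD₁ h₁ _ hD₁C hD₂ h₂ _ hD₂C hmod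
  have hdiamΩ : ∀ x ∈ Ω, ∀ y ∈ Ω, dist x y ≤ K * ρ₀ := by
    intro x hx y hy
    have := dist_le_of_volume_le hΩ.2.isPreconnected (s := σ * ρ₀) (by positivity) (by positivity)
      (fun x hx => exists_ball_subset_of_downwardIn (a := a / 8) (by positivity) (by linarith)
        (fun p hp => (hΩC.hasNormals hα₀ hρ hM₀ hσ1 hσa p hp).imp fun n hn => ⟨hn.1, hn.2.1⟩) hx)
      hvol hx hy
    refine this.trans (le_of_eq ?_)
    rw [← hv, hK]
    field_simp
  have hdiam : ∀ x ∈ closure Ω, ∀ y ∈ closure Ω, dist x y ≤ K * ρ₀ := by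
    intro x hx y hy
    refine (dist_le_diam_of_mem hΩb.closure hx hy).trans ?_
    rw [diam_closure]
    exact diam_le_of_forall_dist_le (by positivity) hdiamΩ
  have key := exists_accessible_point (d := a * σ / 1000 * ρ₀) (s := σ * ρ₀) (k := 1 / q) hρ hΩ.2
    hΩb hΩc hD₁.1 hD₁.2.nonempty h₁ hD₂.1 hD₂.2.nonempty h₂ (by positivity) ha0 ha2
    (by linarith) (by nlinarith) (by positivity) hak (hΩC.hasNormals hα₀ hρ hM₀ hσ1 hσa)
    (hD₁C.hasNormals hα₀ hρ hM₀ hσ1 hσa) (hD₂C.hasNormals hα₀ hρ hM₀ hσ1 hσa) hdiam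
    (c₁ := min 1 (a ^ 2 / 128 * (a * σ / 1000) / K)) (by positivity) (min_le_left _ _) (by
      have h3 : min 1 (a ^ 2 / 128 * (a * σ / 1000) / K) * K ≤ a ^ 2 / 128 * (a * σ / 1000) :=
        (le_div_iff₀ hK0).1 (min_le_right _ _)
      nlinarith) hmod
  rwa [mul_one_div] at key
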